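/- Throughout, $X$ is a finite set, $Y$ is a finite abelian group with $N=|Y|$ elements, and $W$ is a finite set. A quantum query algorithm for $H:X\to Y$ has a query register over $X$, a response register over $Y$ and a private register over $W$; it starts in a fixed unit vector of $\mathbb C^{X\times Y\times W}$, alternates oracle queries $|x,r,w\rangle\mapsto|x,r+H(x),w\rangle$ with arbitrary fixed unitary transformations of the three registers, and finally measures all registers in the computational basis and computes its output from the result. A $2$-collision of $H$ is a set $\{x,x'\}$ with $x\ne x'$ and $H(x)=H(x')$; $j$ distinct $2$-collisions are $j$ pairwise disjoint such sets. Compressed phase oracle: the response register is indexed by the characters $u$ of $Y$ (for $Y=\mathbb Z/N$: $y\mapsto e^{2\pi i uy/N}$, $u\in\mathbb Z/N$), written additively, so that $0$ is the trivial character. The algorithm is run jointly with a database register whose basis states are functions $D:X\to\widehat Y$ (lists of the pairs $(x,D(x))$ with $D(x)\neq 0$), initially the empty list $D=0$; a query is $|x,u,w\rangle|D\rangle\mapsto|x,u,w\rangle|D\oplus(x,u)\rangle$, where $D\oplus(x,u)$ adds $u$ to the entry of $D$ at $x$. After the queries each entry of the database is Fourier transformed: an absent entry $0$ is mapped to $|\bot\rangle$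 and an entry $u\ne0$ to $N^{-1/2}\sum_{y\in Y}u(y)|y\rangle$. Let $f_{i,j}$ be the norm of the projection of the resulting joint state after $i$ queries onto the span of the basis states whose database, a partial function from $X$ to $Y$, contains at least $j$ distinct $2$-collisions (among inputs where it is defined). **Theorem.** 1. For every quantum algorithm and all $i\ge1$, $j\ge1$, $$f_{i,j}<\left(\frac{e\cdot i^{3/2}}{j\sqrt N}\right)^{j}.$$ 2. Finding $j$ distinct $2$-collisions of a uniformly random function $H:X\to Y$ with constant probability needs $\Omega(j^{2/3}N^{1/3})$ quantum queries: for every $p>0$ there are $c>0$ and $N_0$, depending only on $p$, such that for all $X$, $Y$ with $N=|Y|\ge N_0$, all $j\ge1$ and all $q$, every quantum algorithm that makes $q$ queries and outputs $j$ distinct $2$-collisions of $H$ with probability at least $p$ (over $H$ and the measurement) satisfies $q\ge c\,j^{2/3}N^{1/3}$. -/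

import Mathlib

/-- `p` lists `j` distinct 2-collisions of the partial function `D` (`none` means that the value is
not specified): each `p k` consists of two different inputs on which `D` is specified with the same
value, and no input is used by two of the listed collisions. -/
def IsCollisionList {X Y : Type*} {j : ℕ} (D : X → Option Y) (p : Fin j → X × X) : Prop :=
  (∀ k, (p k).1 ≠ (p k).2 ∧ ∃ y : Y, D (p k).1 = some y ∧ D (p k).2 = some y) ∧
  ∀ k l, k ≠ l → Disjoint ({(p k).1, (p k).2} : Set X) {(p l).1, (p l).2}

open Classical in
/-- A quantum query algorithm with query register `X`, response register `R` and private register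
`W`: an initial unit vector of `ℂ^(X × R × W)` and, for each `i`, the unitary transformation of the
three registers that is applied after query number `i + 1`. -/
structure QueryAlgorithm (X R W : Type*) [Fintype X] [Fintype R] [Fintype W] where
  init : X × R × W → ℂ
  init_norm : ∑ a, ‖init a‖ ^ 2 = 1
  U : ℕ → Matrix.unitaryGroup (X × R × W) ℂ

noncomputable section

namespace QueryAlgorithm

/-- One query to the standard oracle: `|x, r, w⟩ ↦ |x, r + H x, w⟩`, extended linearly. -/
def standardQuery {X Y W : Type*} [AddCommGroup Y] (H : X → Y) (ψ : X × Y × W → ℂ) :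
    X × Y × W → ℂ :=
  fun a => ψ (a.1, a.2.1 - H a.1, a.2.2)

/-- The state of the algorithm after `i` queries to the function `H`. -/
def standardState {X Y W : Type*} [Fintype X] [Fintype Y] [Fintype W] [AddCommGroup Y]
    (A : QueryAlgorithm X Y W) (H : X → Y) : ℕ → (X × Y × W → ℂ)
  | 0 => A.init
  | i + 1 => (A.U i : Matrix (X × Y × W) (X × Y × W) ℂ).mulVec
      (standardQuery H (A.standardState H i))

open Classical in
/-- The probability, over a uniformly random `H : X → Y` and the measurement of all registers in
the computational basis after `q` queries, that the list `out a` computed from the measurement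
result `a` consists of `j` distinct 2-collisions of `H`. -/
def successProb {X Y W : Type*} [Fintype X] [Fintype Y] [Fintype W] [AddCommGroup Y]
    (A : QueryAlgorithm X Y W) (q : ℕ) {j : ℕ} (out : X × Y × W → Fin j → X × X) : ℝ :=
  (∑ H : X → Y, ∑ a, if IsCollisionList (fun x => some (H x)) (out a)
    then ‖A.standardState H q a‖ ^ 2 else 0) / (Fintype.card (X → Y) : ℝ)

open Classical in
/-- One query in the compressed Fourier oracle model, `|x, u, w⟩|D⟩ ↦ |x, u, w⟩|D ⊕ (x, u)⟩`, where
`D ⊕ (x, u)` adds `u` to the entry of `D` at `x`. The values `u` are the characters of the group `Y`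
(for `Y = ℤ/N` the character `u` is `y ↦ exp (2 π i u y / N)`). A database is a list of pairs
`(x, u)` with `u ≠ 0` and distinct `x`; it is represented by the function on `X` that is `0` at the
points that are not in the list. -/
def compressedQuery {X Y W : Type*} [AddCommGroup Y]
    (ψ : X × AddChar Y ℂ × W → (X → AddChar Y ℂ) → ℂ) :
    X × AddChar Y ℂ × W → (X → AddChar Y ℂ) → ℂ :=
  fun a D => ψ a (Function.update D a.1 (D a.1 - a.2.1))

open Classical in
/-- The joint state of the algorithm and of the compressed Fourier database after `i` queries; the
database is empty at the beginning. -/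
def fourierState {X Y W : Type*} [Fintype X] [Fintype Y] [Fintype W] [AddCommGroup Y]
    (A : QueryAlgorithm X (AddChar Y ℂ) W) :
    ℕ → (X × AddChar Y ℂ × W → (X → AddChar Y ℂ) → ℂ)
  | 0 => fun a D => if D = 0 then A.init a else 0
  | i + 1 => fun a D =>
      (A.U i : Matrix (X × AddChar Y ℂ × W) (X × AddChar Y ℂ × W) ℂ).mulVec
        (fun b => compressedQuery (A.fourierState i) b D) a

open Classical in
/-- The quantum Fourier transform of one database entry: the missing entry `0` stays missing, and
an entry `u ≠ 0` becomes `N^(-1/2) ∑ y, u(y) |y⟩`, with `N = |Y|`. The value is the amplitude of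
the second argument. -/
def entryAmplitude {Y : Type*} [Fintype Y] [AddCommGroup Y] (u : AddChar Y ℂ) : Option Y → ℂ
  | none => if u = 0 then 1 else 0
  | some y => if u = 0 then 0 else u y / (Real.sqrt (Fintype.card Y) : ℂ)

open Classical in
/-- The joint state after `i` queries in the compressed phase oracle model: the Fourier transform
is applied to all entries of the compressed Fourier database. In the resulting database `D`,
`D x = some y` means that the pair `(x, y)` is in `D`. -/
def phaseState {X Y W : Type*} [Fintype X] [Fintype Y] [Fintype W] [AddCommGroup Y]
    (A : QueryAlgorithm X (AddChar Y ℂ) W) (i : ℕ)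
    (a : X × AddChar Y ℂ × W) (D : X → Option Y) : ℂ :=
  ∑ E : X → AddChar Y ℂ, A.fourierState i a E * ∏ x, entryAmplitude (E x) (D x)

open Classical in
/-- The amplitude `f i j`: the norm of the projection of the state after `i` queries, in the
compressed phase oracle model, to the span of the basis states whose database contains at least
`j` distinct 2-collisions. -/
def collisionAmplitude {X Y W : Type*} [Fintype X] [Fintype Y] [Fintype W] [AddCommGroup Y]
    (A : QueryAlgorithm X (AddChar Y ℂ) W) (i j : ℕ) : ℝ :=
  Real.sqrt (∑ a, ∑ D : X → Option Y,
    if ∃ p : Fin j → X × X, IsCollisionList D p then ‖A.phaseState i a D‖ ^ 2 else 0)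

end QueryAlgorithm

end

/-! Decompressing a database entry replaces the missing value by the uniform superposition. The
recorded values come from nontrivial characters, which are orthogonal to it, so decompression is
isometric, and on a decompressed entry a query is multiplication by `u y`. Compressing back moves
little amplitude into a small set `S` of values: at most a fraction `√(2|S|/N)` of the norm on that
entry (`sum_norm_query_sq_le`).

After `i` queries the database has at most `i` entries. Hence at most `i` values of the queried
entry create a new collision, and one query raises the number of disjoint collisions by at most one.
With `f` for `collisionAmplitude` this gives `f (i+1) (j+1) ≤ f i (j+1) + √(2i/N) f i j`
(`collisionAmplitude_succ_succ_le`). Since `√(2i) ≤ (i+1)^(3/2) - i^(3/2)`, induction yields `f i j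
≤ (i^(3/2)/√N)^j / j!` (`collisionAmplitude_le`), and `j^j < e^j j!` finishes the first claim.

For the second claim, the run on a random `H` is the compressed run, in the character basis of the
response register, with every entry decompressed (`standardState_eq_mixedState`). Entries outside
the announced pairs are decompressed at no cost. An announced pair costs a factor 4 in probability
if it already collides in the database and contributes a factor `4/N` otherwise. Either at least
`⌈j/2⌉` announced pairs collide in the database or at least `⌈j/2⌉` factors `1/N` appear, so the
success probability is at most `4^j (f(q, ⌈j/2⌉)² + N^(-⌈j/2⌉))` (`successProb_le`). For large `N`
the second term is below `p/2`, and the first claim forces `q` to be large. -/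

/-! ### Finite sums, Minkowski inequalities and isometries -/

section Finite

-- Splits a sum over databases into fibres on which only the entry at `x` varies; this lifts
-- estimates for one entry to the whole state.
open scoped Classical in
theorem sum_update_eq {X β M : Type*} [Fintype X] [Fintype β] [AddCommMonoid M] (x : X)
    (F : (X → β) → M) :
    ∑ D, ∑ d, F (Function.update D x d) = Fintype.card β • ∑ D, F D := by
  have h : ∀ G : (X → β) → M,
      ∑ D, G D = ∑ q : β × ({j // j ≠ x} → β), G ((Equiv.funSplitAt x β).symm q) := fun G =>
    ((Equiv.funSplitAt x β).symm.sum_comp G).symm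
  have hu : ∀ (q : β × ({j // j ≠ x} → β)) (d : β),
      Function.update ((Equiv.funSplitAt x β).symm q) x d
        = (Equiv.funSplitAt x β).symm (d, q.2) := by
    intro q d
    funext z
    by_cases hz : z = x
    · subst hz; simp
    · simp [hz]
  rw [h, h]
  simp only [hu, Fintype.sum_prod_type]
  rw [Finset.sum_const, Finset.card_univ, Finset.sum_comm]

theorem sum_norm_add_sq_le {ι : Type*} (s : Finset ι) (f g : ι → ℂ) :
    ∑ k ∈ s, ‖f k + g k‖ ^ 2 ≤ (√(∑ k ∈ s, ‖f k‖ ^ 2) + √(∑ k ∈ s, ‖g k‖ ^ 2)) ^ 2 := by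
  have h1 : ∑ k ∈ s, ‖f k + g k‖ ^ 2 ≤
      ∑ k ∈ s, (‖f k‖ ^ 2 + ‖g k‖ ^ 2 + 2 * (√(‖f k‖ ^ 2) * √(‖g k‖ ^ 2))) := by
    refine Finset.sum_le_sum fun k _ => ?_
    rw [Real.sqrt_sq (norm_nonneg _), Real.sqrt_sq (norm_nonneg _)]
    nlinarith [norm_add_le (f k) (g k), norm_nonneg (f k + g k)]
  have h2 := Real.sum_sqrt_mul_sqrt_le s (f := fun k => ‖f k‖ ^ 2) (g := fun k => ‖g k‖ ^ 2)
    (fun _ => sq_nonneg _) (fun _ => sq_nonneg _)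
  rw [Finset.sum_add_distrib, Finset.sum_add_distrib, ← Finset.mul_sum] at h1
  have h3 := Real.sq_sqrt (Finset.sum_nonneg fun k (_ : k ∈ s) => sq_nonneg ‖f k‖)
  have h4 := Real.sq_sqrt (Finset.sum_nonneg fun k (_ : k ∈ s) => sq_nonneg ‖g k‖)
  nlinarith

/-- Minkowski's inequality in `ℓ²` for the sequences `√a` and `√b`; it glues the estimates on the
individual fibres. -/
theorem sum_sqrt_add_sqrt_sq_le {ι : Type*} (s : Finset ι) (a b : ι → ℝ) (ha : ∀ k, 0 ≤ a k)
    (hb : ∀ k, 0 ≤ b k) :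
    ∑ k ∈ s, (√(a k) + √(b k)) ^ 2 ≤ (√(∑ k ∈ s, a k) + √(∑ k ∈ s, b k)) ^ 2 := by
  have h1 : ∑ k ∈ s, (√(a k) + √(b k)) ^ 2 = ∑ k ∈ s, (a k + b k + 2 * (√(a k) * √(b k))) := by
    refine Finset.sum_congr rfl fun k _ => ?_
    linear_combination Real.sq_sqrt (ha k) + Real.sq_sqrt (hb k)
  have h2 := Real.sum_sqrt_mul_sqrt_le s ha hb
  have h3 := Real.sq_sqrt (Finset.sum_nonneg fun k (_ : k ∈ s) => ha k)
  have h4 := Real.sq_sqrt (Finset.sum_nonneg fun k (_ : k ∈ s) => hb k)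
  rw [h1, Finset.sum_add_distrib, Finset.sum_add_distrib, ← Finset.mul_sum]
  nlinarith

theorem norm_sum_sq_le {Y : Type*} [Fintype Y] (z : Y → ℂ) :
    ‖∑ y, z y‖ ^ 2 ≤ Fintype.card Y * ∑ y, ‖z y‖ ^ 2 := by
  refine (pow_le_pow_left₀ (norm_nonneg _) (norm_sum_le _ _) 2).trans ?_
  exact sq_sum_le_card_mul_sum_sq

theorem norm_mean_sq_le {Y : Type*} [Fintype Y] [Nonempty Y] (z : Y → ℂ) :
    ‖(∑ y, z y) / Fintype.card Y‖ ^ 2 ≤ (∑ y, ‖z y‖ ^ 2) / Fintype.card Y := by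
  have hN : (0 : ℝ) < Fintype.card Y := by exact_mod_cast Fintype.card_pos
  rw [norm_div, div_pow, Complex.norm_natCast, div_le_div_iff₀ (by positivity) hN]
  nlinarith [norm_sum_sq_le z]

/-- The variance identity: subtracting the mean is an orthogonal projection, in particular a
contraction. -/
theorem sum_norm_sub_mean_sq {Y : Type*} [Fintype Y] [Nonempty Y] (z : Y → ℂ) :
    ∑ y, ‖z y - (∑ h, z h) / Fintype.card Y‖ ^ 2
      = ∑ y, ‖z y‖ ^ 2 - Fintype.card Y * ‖(∑ h, z h) / Fintype.card Y‖ ^ 2 := by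
  have hN : (Fintype.card Y : ℂ) ≠ 0 := by exact_mod_cast Fintype.card_ne_zero
  set m := (∑ h, z h) / (Fintype.card Y : ℂ) with hm
  have hs : ∑ h, z h = Fintype.card Y * m := by rw [hm]; field_simp
  have key : ∀ y, ‖z y - m‖ ^ 2 = ‖z y‖ ^ 2 + ‖m‖ ^ 2
      - 2 * (z y * (starRingEnd ℂ) m).re := by
    intro y
    rw [Complex.sq_norm, Complex.sq_norm, Complex.sq_norm, Complex.normSq_sub]
  simp only [key, Finset.sum_sub_distrib, Finset.sum_add_distrib, ← Finset.mul_sum,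
    ← Complex.re_sum, ← Finset.sum_mul]
  rw [hs, mul_assoc, Complex.mul_conj, Finset.sum_const, Finset.card_univ, nsmul_eq_mul,
    Complex.sq_norm, ← Complex.ofReal_natCast, ← Complex.ofReal_mul, Complex.ofReal_re]
  ring

theorem sum_norm_mulVec_sq {I J : Type*} [Fintype I] [Fintype J] [DecidableEq J]
    (V : Matrix I J ℂ) (hV : V.conjTranspose * V = 1) (z : J → ℂ) :
    ∑ a, ‖V.mulVec z a‖ ^ 2 = ∑ b, ‖z b‖ ^ 2 := by
  have : ((∑ a, ‖V.mulVec z a‖ ^ 2 : ℝ) : ℂ) = ((∑ b, ‖z b‖ ^ 2 : ℝ) : ℂ) := by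
    have e1 : ((∑ a, ‖V.mulVec z a‖ ^ 2 : ℝ) : ℂ)
        = dotProduct (star (V.mulVec z)) (V.mulVec z) := by
      simp [dotProduct, Complex.conj_mul']
    have e2 : ((∑ b, ‖z b‖ ^ 2 : ℝ) : ℂ) = dotProduct (star z) z := by
      simp [dotProduct, Complex.conj_mul']
    rw [e1, e2, Matrix.star_mulVec, ← Matrix.dotProduct_mulVec, Matrix.mulVec_mulVec, hV,
      Matrix.one_mulVec]
  exact_mod_cast this

end Finite

/-! ### The effect of a query on one database entry -/

section LocalQuery

variable {Y : Type*} [Fintype Y] [Nonempty Y]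

/-- Replacing the component along the uniform superposition by the missing entry is isometric. -/
theorem sum_norm_uniform_add_sq (v : Option Y → ℂ) (hv : ∑ y, v (some y) = 0) :
    ∑ y, ‖v none / (√(Fintype.card Y) : ℂ) + v (some y)‖ ^ 2 = ∑ d, ‖v d‖ ^ 2 := by
  have hN : (0 : ℝ) < Fintype.card Y := by exact_mod_cast Fintype.card_pos
  have hN' : (Fintype.card Y : ℂ) ≠ 0 := by exact_mod_cast Fintype.card_ne_zero
  have h := sum_norm_sub_mean_sq fun y => v none / (√(Fintype.card Y) : ℂ) + v (some y)
  have hm : (∑ y, (v none / (√(Fintype.card Y) : ℂ) + v (some y))) / (Fintype.card Y : ℂ)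
      = v none / (√(Fintype.card Y) : ℂ) := by
    rw [Finset.sum_add_distrib, hv, add_zero, Finset.sum_const, Finset.card_univ, nsmul_eq_mul]
    field_simp
  rw [hm] at h
  simp only [add_sub_cancel_left] at h
  rw [norm_div, div_pow, Complex.norm_real, Real.norm_of_nonneg (Real.sqrt_nonneg _),
    Real.sq_sqrt hN.le] at h
  rw [Fintype.sum_option, h]
  field_simp
  ring

/-- A query acts isometrically on the queried database entry. -/
theorem sum_norm_query_sq (v v' : Option Y → ℂ) (u : Y → ℂ) (hu : ∀ y, ‖u y‖ = 1)
    (hv : ∑ y, v (some y) = 0) (hv' : ∑ y, v' (some y) = 0)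
    (h : ∀ y, v' none / (√(Fintype.card Y) : ℂ) + v' (some y)
      = u y * (v none / (√(Fintype.card Y) : ℂ) + v (some y))) :
    ∑ d, ‖v' d‖ ^ 2 = ∑ d, ‖v d‖ ^ 2 := by
  rw [← sum_norm_uniform_add_sq v hv, ← sum_norm_uniform_add_sq v' hv']
  simp only [h, norm_mul, hu, one_mul]

/-- The amplitude that one query moves into a set `S` of values of the queried entry. -/
theorem sum_norm_query_sq_le [AddCommGroup Y] (v v' : Option Y → ℂ) (u : AddChar Y ℂ)
    (hv' : ∑ y, v' (some y) = 0)
    (h : ∀ y, v' none / (√(Fintype.card Y) : ℂ) + v' (some y)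
      = u y * (v none / (√(Fintype.card Y) : ℂ) + v (some y))) (S : Finset Y) :
    ∑ y ∈ S, ‖v' (some y)‖ ^ 2 ≤ (√(∑ y ∈ S, ‖v (some y)‖ ^ 2)
      + √(2 * S.card / Fintype.card Y * ∑ d, ‖v d‖ ^ 2)) ^ 2 := by
  classical
  have hN : (0 : ℝ) < Fintype.card Y := by exact_mod_cast Fintype.card_pos
  have hN' : (Fintype.card Y : ℂ) ≠ 0 := by exact_mod_cast Fintype.card_ne_zero
  have hu : ∀ y, ‖u y‖ = 1 := fun y => u.norm_apply y
  set n : ℂ := (Fintype.card Y : ℂ) with hn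
  set r : ℂ := (√(Fintype.card Y) : ℂ) with hr
  -- The amplitude after the query is split by origin: `σ` was already in `S`, `φ` comes from the
  -- other recorded values, `ζ` from the missing entry. The part of `σ` is contracted by subtracting
  -- its mean; the other two are of size `N^(-1/2)` at each point, so they are charged to `|S|`.
  let σ : Y → ℂ := fun y => if y ∈ S then u y * v (some y) else 0
  let φ : Y → ℂ := fun y => if y ∈ S then 0 else u y * v (some y)
  let ζ : Y → ℂ := fun y => v none / r * (u y - (∑ h, u h) / n)
  have hsplit : ∀ y ∈ S, v' (some y)
      = (σ y - (∑ h, σ h) / n) + (ζ y - (∑ h, φ h) / n) := by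
    intro y hy
    have hsum : ∑ y, (v' none / r + v' (some y)) = n * (v' none / r) := by
      rw [Finset.sum_add_distrib, hv', add_zero, Finset.sum_const, Finset.card_univ,
        nsmul_eq_mul]
    have hmean : v' none / r = (∑ h, u h * (v none / r + v (some h))) / n := by
      simp only [← h]
      rw [hsum]
      field_simp
    have hdec : ∑ h, u h * (v none / r + v (some h))
        = v none / r * ∑ h, u h + ∑ h, σ h + ∑ h, φ h := by
      rw [Finset.mul_sum, ← Finset.sum_add_distrib, ← Finset.sum_add_distrib]
      refine Finset.sum_congr rfl fun y _ => ?_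
      simp only [σ, φ]
      split_ifs <;> ring
    have h1 : v' (some y) = u y * (v none / r + v (some y)) - v' none / r := by
      rw [← h]; ring
    rw [h1, hmean, hdec]
    simp only [ζ, σ, hy, if_true]
    ring
  have hA : ∑ y ∈ S, ‖σ y - (∑ h, σ h) / n‖ ^ 2 ≤ ∑ y ∈ S, ‖v (some y)‖ ^ 2 := by
    calc ∑ y ∈ S, ‖σ y - (∑ h, σ h) / n‖ ^ 2 ≤ ∑ y, ‖σ y - (∑ h, σ h) / n‖ ^ 2 :=
          Finset.sum_le_univ_sum_of_nonneg fun _ => sq_nonneg _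
      _ ≤ ∑ y, ‖σ y‖ ^ 2 := by
          rw [sum_norm_sub_mean_sq]
          have : 0 ≤ (Fintype.card Y : ℝ) * ‖(∑ h, σ h) / n‖ ^ 2 := by positivity
          linarith
      _ = ∑ y ∈ S, ‖v (some y)‖ ^ 2 := by
          rw [← Finset.sum_filter_add_sum_filter_not Finset.univ (· ∈ S)]
          simp +contextual [σ, hu, Finset.sum_filter]
  have hζ : ∀ y, ‖ζ y‖ ^ 2 ≤ ‖v none‖ ^ 2 / Fintype.card Y := by
    intro y
    -- A trivial character equals its mean, and a nontrivial one has mean zero.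
    have h1 : ‖u y - (∑ h, u h) / n‖ ≤ 1 := by
      rw [AddChar.sum_eq_ite]
      split_ifs with h0
      · rw [div_self hN', h0]; simp
      · simp [hu]
    have h2 : ‖v none / r‖ ^ 2 = ‖v none‖ ^ 2 / Fintype.card Y := by
      rw [norm_div, div_pow, hr, Complex.norm_real, Real.norm_of_nonneg (Real.sqrt_nonneg _),
        Real.sq_sqrt hN.le]
    rw [← h2]
    simp only [ζ, norm_mul]
    exact pow_le_pow_left₀ (by positivity) (mul_le_of_le_one_right (norm_nonneg _) h1) 2
  have hφ : ‖(∑ h, φ h) / n‖ ^ 2 ≤ (∑ y, ‖v (some y)‖ ^ 2) / Fintype.card Y := by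
    refine (norm_mean_sq_le φ).trans ?_
    gcongr with y
    simp only [φ]
    split_ifs <;> simp [hu]
  have hB : ∑ y ∈ S, ‖ζ y - (∑ h, φ h) / n‖ ^ 2
      ≤ 2 * S.card / Fintype.card Y * ∑ d, ‖v d‖ ^ 2 := by
    have : ∀ y ∈ S, ‖ζ y - (∑ h, φ h) / n‖ ^ 2 ≤ 2 / Fintype.card Y * ∑ d, ‖v d‖ ^ 2 := by
      intro y _
      have h1 : ‖ζ y - (∑ h, φ h) / n‖ ^ 2 ≤ 2 * ‖ζ y‖ ^ 2 + 2 * ‖(∑ h, φ h) / n‖ ^ 2 := by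
        nlinarith [norm_sub_le (ζ y) ((∑ h, φ h) / n), norm_nonneg (ζ y - (∑ h, φ h) / n),
          sq_nonneg (‖ζ y‖ - ‖(∑ h, φ h) / n‖)]
      have h2 := hζ y
      rw [Fintype.sum_option]
      calc _ ≤ _ := h1
        _ ≤ 2 * (‖v none‖ ^ 2 / Fintype.card Y)
            + 2 * ((∑ y, ‖v (some y)‖ ^ 2) / Fintype.card Y) := by linarith
        _ = _ := by ring
    refine (Finset.sum_le_card_nsmul _ _ _ this).trans (le_of_eq ?_)
    rw [nsmul_eq_mul]
    ring
  rw [Finset.sum_congr rfl fun y hy => by rw [hsplit y hy]]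
  refine (sum_norm_add_sq_le S _ _).trans ?_
  gcongr

end LocalQuery

/-! ### Databases with some entries decompressed -/

section MixedState

open scoped Classical

variable {X Y : Type*} [Fintype X] [Fintype Y] [AddCommGroup Y]

/-- The Fourier transform of a database entry without the convention on missing entries. -/
noncomputable def fullAmplitude (u : AddChar Y ℂ) : Option Y → ℂ
  | none => 0
  | some y => u y / (√(Fintype.card Y) : ℂ)

/-- The database state obtained from the Fourier amplitudes `g` when the entries in `s` are
decompressed and the other ones are not. -/
noncomputable def mixedState (g : (X → AddChar Y ℂ) → ℂ) (s : Finset X) (D : X → Option Y) : ℂ :=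
  ∑ E : X → AddChar Y ℂ, g E * ∏ x, if x ∈ s then fullAmplitude (E x) (D x)
    else QueryAlgorithm.entryAmplitude (E x) (D x)

/-- The amplitude of `mixedState`, with the factor of the entry at `x` replaced by `c`. -/
noncomputable def mixedStateWith (g : (X → AddChar Y ℂ) → ℂ) (s : Finset X) (D : X → Option Y)
    (x : X) (c : AddChar Y ℂ → ℂ) : ℂ :=
  ∑ E : X → AddChar Y ℂ, g E * (c (E x) * ∏ z ∈ Finset.univ.erase x,
    if z ∈ s then fullAmplitude (E z) (D z) else QueryAlgorithm.entryAmplitude (E z) (D z))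

theorem fullAmplitude_some (u : AddChar Y ℂ) (y : Y) :
    fullAmplitude u (some y) = QueryAlgorithm.entryAmplitude u none / (√(Fintype.card Y) : ℂ)
      + QueryAlgorithm.entryAmplitude u (some y) := by
  by_cases hu : u = 0 <;> simp [fullAmplitude, QueryAlgorithm.entryAmplitude, hu]

theorem sum_entryAmplitude_some (u : AddChar Y ℂ) :
    ∑ y, QueryAlgorithm.entryAmplitude u (some y) = 0 := by
  by_cases hu : u = 0
  · simp [QueryAlgorithm.entryAmplitude, hu]
  · simp [QueryAlgorithm.entryAmplitude, hu, ← Finset.sum_div, AddChar.sum_eq_ite]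

theorem mixedState_update (g : (X → AddChar Y ℂ) → ℂ) (s : Finset X) (D : X → Option Y) (x : X)
    (d : Option Y) :
    mixedState g s (Function.update D x d) = mixedStateWith g s D x fun u =>
      if x ∈ s then fullAmplitude u d else QueryAlgorithm.entryAmplitude u d := by
  refine Finset.sum_congr rfl fun E _ => ?_
  rw [← Finset.mul_prod_erase _ _ (Finset.mem_univ x), Function.update_self]
  congr 2
  refine Finset.prod_congr rfl fun z hz => ?_
  rw [Function.update_of_ne (Finset.ne_of_mem_erase hz)]

theorem mixedStateWith_insert (g : (X → AddChar Y ℂ) → ℂ) (s : Finset X) (D : X → Option Y)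
    (x : X) (c : AddChar Y ℂ → ℂ) :
    mixedStateWith g (insert x s) D x c = mixedStateWith g s D x c := by
  refine Finset.sum_congr rfl fun E _ => ?_
  congr 2
  refine Finset.prod_congr rfl fun z hz => ?_
  simp [Finset.ne_of_mem_erase hz]

theorem mixedState_insert_none (g : (X → AddChar Y ℂ) → ℂ) (s : Finset X) (D : X → Option Y)
    (x : X) : mixedState g (insert x s) (Function.update D x none) = 0 := by
  rw [mixedState_update]
  simp [mixedStateWith, fullAmplitude]

/-- Together with `sum_mixedState_some` this puts each fibre into the form required by the one-entry
estimates: a missing amplitude spread uniformly, plus a part of sum zero. -/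
theorem mixedState_insert_some (g : (X → AddChar Y ℂ) → ℂ) (s : Finset X) (D : X → Option Y)
    (x : X) (hx : x ∉ s) (y : Y) :
    mixedState g (insert x s) (Function.update D x (some y))
      = mixedState g s (Function.update D x none) / (√(Fintype.card Y) : ℂ)
        + mixedState g s (Function.update D x (some y)) := by
  simp only [mixedState_update, mixedStateWith_insert, hx, Finset.mem_insert_self, if_true,
    if_false, fullAmplitude_some]
  simp only [mixedStateWith, Finset.sum_div, ← Finset.sum_add_distrib]
  refine Finset.sum_congr rfl fun E _ => ?_
  ring

theorem sum_mixedState_some (g : (X → AddChar Y ℂ) → ℂ) (s : Finset X) (D : X → Option Y)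
    (x : X) (hx : x ∉ s) : ∑ y, mixedState g s (Function.update D x (some y)) = 0 := by
  simp only [mixedState_update, hx, if_false, mixedStateWith]
  rw [Finset.sum_comm]
  refine Finset.sum_eq_zero fun E _ => ?_
  rw [← Finset.mul_sum, ← Finset.sum_mul, sum_entryAmplitude_some]
  simp

/-- A query is diagonal on the decompressed entry. -/
theorem mixedState_query (g : (X → AddChar Y ℂ) → ℂ) (D : X → Option Y) (x : X)
    (u : AddChar Y ℂ) (y : Y) :
    mixedState (fun E => g (Function.update E x (E x - u))) {x} (Function.update D x (some y))
      = u y * mixedState g {x} (Function.update D x (some y)) := by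
  simp only [mixedState_update, Finset.mem_singleton, if_true, mixedStateWith]
  -- Reindexing by this shift undoes the query inside `g`; the factor `u y` then comes from
  -- evaluating `E x + u` at `y`.
  let e : (X → AddChar Y ℂ) ≃ (X → AddChar Y ℂ) :=
    { toFun := fun E => Function.update E x (E x + u)
      invFun := fun E => Function.update E x (E x - u)
      left_inv := fun E => by simp
      right_inv := fun E => by simp }
  rw [← e.sum_comp, Finset.mul_sum]
  refine Finset.sum_congr rfl fun E _ => ?_
  have h1 : Function.update (e E) x (e E x - u) = E := e.left_inv E
  have h2 : ∏ z ∈ Finset.univ.erase x, (if z = x then fullAmplitude (e E z) (D z)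
      else QueryAlgorithm.entryAmplitude (e E z) (D z))
      = ∏ z ∈ Finset.univ.erase x, (if z = x then fullAmplitude (E z) (D z)
      else QueryAlgorithm.entryAmplitude (E z) (D z)) := by
    refine Finset.prod_congr rfl fun z hz => ?_
    simp [e, Finset.ne_of_mem_erase hz]
  rw [h1, h2]
  have h3 : e E x = E x + u := by simp [e]
  rw [h3]
  simp only [fullAmplitude, AddChar.add_apply]
  ring

theorem mixedState_query_some (g : (X → AddChar Y ℂ) → ℂ) (D : X → Option Y) (x : X)
    (u : AddChar Y ℂ) (y : Y) :
    mixedState (fun E => g (Function.update E x (E x - u))) ∅ (Function.update D x none)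
        / (√(Fintype.card Y) : ℂ)
      + mixedState (fun E => g (Function.update E x (E x - u))) ∅ (Function.update D x (some y))
    = u y * (mixedState g ∅ (Function.update D x none) / (√(Fintype.card Y) : ℂ)
      + mixedState g ∅ (Function.update D x (some y))) := by
  have h := mixedState_query g D x u y
  rwa [← insert_empty_eq, mixedState_insert_some _ _ _ _ (Finset.notMem_empty x),
    mixedState_insert_some _ _ _ _ (Finset.notMem_empty x)] at h

/-- In the compressed encoding the trivial character has amplitude only on `none`, so the Fourier
transform cannot enlarge the support of a database. -/
theorem mixedState_empty_ne_zero {g : (X → AddChar Y ℂ) → ℂ} {i : ℕ}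
    (hg : ∀ E, g E ≠ 0 → (Finset.univ.filter fun x => E x ≠ 0).card ≤ i) (D : X → Option Y)
    (hD : mixedState g ∅ D ≠ 0) : (Finset.univ.filter fun x => D x ≠ none).card ≤ i := by
  obtain ⟨E, -, hE⟩ := Finset.exists_ne_zero_of_sum_ne_zero hD
  refine (Finset.card_le_card fun x hx => ?_).trans (hg E (left_ne_zero_of_mul hE))
  have h := Finset.prod_ne_zero_iff.1 (right_ne_zero_of_mul hE) x (Finset.mem_univ x)
  simp only [Finset.mem_filter, Finset.mem_univ, true_and, Finset.notMem_empty, if_false] at hx h ⊢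
  rintro h0
  obtain ⟨y, hy⟩ := Option.ne_none_iff_exists'.1 hx
  rw [hy, h0] at h
  simp [QueryAlgorithm.entryAmplitude] at h

end MixedState

/-! ### Combinatorics of disjoint collisions -/

section Collisions

open scoped Classical

variable {X Y : Type*}

/-- `D` contains at least `j` distinct 2-collisions. -/
def HasCollisions (D : X → Option Y) (j : ℕ) : Prop :=
  ∃ p : Fin j → X × X, IsCollisionList D p

theorem HasCollisions.zero (D : X → Option Y) : HasCollisions D 0 :=
  ⟨fun k => k.elim0, fun k => k.elim0, isEmptyElim⟩

theorem IsCollisionList.comp {D : X → Option Y} {j m : ℕ} {p : Fin j → X × X}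
    (hp : IsCollisionList D p) (f : Fin m ↪ Fin j) : IsCollisionList D (p ∘ f) :=
  ⟨fun k => hp.1 (f k), fun _ _ hkl => hp.2 _ _ (f.injective.ne hkl)⟩

theorem IsCollisionList.congr {D D' : X → Option Y} {j : ℕ} {p : Fin j → X × X}
    (hp : IsCollisionList D p) (h : ∀ k, D' (p k).1 = D (p k).1 ∧ D' (p k).2 = D (p k).2) :
    IsCollisionList D' p :=
  ⟨fun k => by rw [(h k).1, (h k).2]; exact hp.1 k, hp.2⟩

theorem HasCollisions.update_of_none {D : X → Option Y} {j : ℕ} {x : X}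
    (h : HasCollisions (Function.update D x none) j) (d : Option Y) :
    HasCollisions (Function.update D x d) j := by
  obtain ⟨p, hp⟩ := h
  refine ⟨p, hp.congr fun k => ?_⟩
  obtain ⟨-, y, h1, h2⟩ := hp.1 k
  have e1 : (p k).1 ≠ x := by rintro e; simp [e] at h1
  have e2 : (p k).2 ≠ x := by rintro e; simp [e] at h2
  simp [e1, e2]

/-- Changing one entry destroys at most one collision, and if it does, the value of that entry
occurs elsewhere. -/
theorem HasCollisions.update_succ {D : X → Option Y} {j : ℕ} {x : X} {c : Option Y}
    (h : HasCollisions (Function.update D x c) (j + 1)) :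
    (∀ d, HasCollisions (Function.update D x d) j) ∧
    (HasCollisions (Function.update D x none) (j + 1) ∨ ∃ z ≠ x, c ≠ none ∧ D z = c) := by
  obtain ⟨p, hp⟩ := h
  -- If no pair uses `x`, the list survives any change at `x`. Otherwise, by disjointness, exactly
  -- one pair uses it: dropping that pair leaves `j` collisions, and its other input carries the
  -- value `c`.
  by_cases hx : ∀ k, (p k).1 ≠ x ∧ (p k).2 ≠ x
  · have hd : ∀ d, IsCollisionList (Function.update D x d) p := fun d =>
      hp.congr fun k => by simp [hx k]
    exact ⟨fun d => ⟨_, (hd d).comp (Fin.castSuccEmb)⟩, Or.inl ⟨p, hd none⟩⟩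
  · push Not at hx
    obtain ⟨k, hk⟩ := hx
    have hxk : x ∈ ({(p k).1, (p k).2} : Set X) := by
      by_cases h1 : (p k).1 = x
      · simp [h1]
      · simp [hk h1]
    constructor
    · refine fun d => ⟨p ∘ k.succAbove, (hp.comp k.succAboveEmb).congr fun l => ?_⟩
      have hd := hp.2 _ _ (k.succAbove_ne l)
      have e1 : (p (k.succAbove l)).1 ≠ x := fun e =>
        Set.disjoint_left.1 hd (by simp) (e ▸ hxk)
      have e2 : (p (k.succAbove l)).2 ≠ x := fun e =>
        Set.disjoint_left.1 hd (by simp) (e ▸ hxk)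
      simp [e1, e2]
    · right
      obtain ⟨hne, y, h1, h2⟩ := hp.1 k
      by_cases e : (p k).1 = x
      · have e2 : (p k).2 ≠ x := fun e' => hne (e.trans e'.symm)
        rw [e, Function.update_self] at h1
        rw [Function.update_of_ne e2] at h2
        exact ⟨_, e2, by simp [h1], by rw [h2, h1]⟩
      · rw [hk e, Function.update_self] at h2
        rw [Function.update_of_ne e] at h1
        exact ⟨_, e, by simp [h2], by rw [h2, h1]⟩

/-- The number of values of the entry at `x` that create a new collision is at most the number of
other entries. -/
theorem card_collision_values_le [Fintype X] [Fintype Y] {D : X → Option Y} {x : X} {i j : ℕ} {d : Option Y}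
    (hi : (Finset.univ.filter fun z => Function.update D x d z ≠ none).card ≤ i)
    (hn : ¬ HasCollisions (Function.update D x none) (j + 1)) :
    (Finset.univ.filter fun y => HasCollisions (Function.update D x (some y)) (j + 1)).card
      ≤ i := by
  refine le_trans ?_ hi
  rw [← Finset.card_image_of_injective (Finset.univ.filter fun y => HasCollisions _ _)
    (Option.some_injective Y)]
  refine (Finset.card_le_card (t := (Finset.univ.filter fun z =>
    Function.update D x d z ≠ none).image (Function.update D x d)) ?_).trans
      Finset.card_image_le
  intro c hc
  obtain ⟨y, hy, rfl⟩ := Finset.mem_image.1 hc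
  rcases (Finset.mem_filter.1 hy).2.update_succ.2 with h | ⟨z, hz, -, hD⟩
  · exact absurd h hn
  · refine Finset.mem_image.2 ⟨z, ?_, ?_⟩ <;> simp [hz, hD]

end Collisions

/-! ### The recursion for the collision amplitudes -/

namespace QueryAlgorithm

open scoped Classical

variable {X Y W : Type*} [Fintype X] [Fintype Y] [Fintype W] [AddCommGroup Y]

theorem phaseState_eq_mixedState (A : QueryAlgorithm X (AddChar Y ℂ) W) (i : ℕ)
    (a : X × AddChar Y ℂ × W) (D : X → Option Y) :
    A.phaseState i a D = mixedState (A.fourierState i a) ∅ D := by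
  simp [phaseState, mixedState]

/-- A query changes only the entry at the queried input, and the unitaries do not touch the
database. -/
theorem card_support_le_of_fourierState_ne_zero (A : QueryAlgorithm X (AddChar Y ℂ) W) (i : ℕ)
    (a : X × AddChar Y ℂ × W) (E : X → AddChar Y ℂ) (h : A.fourierState i a E ≠ 0) :
    (Finset.univ.filter fun x => E x ≠ 0).card ≤ i := by
  induction i generalizing a E with
  | zero =>
    have hE : E = 0 := by
      by_contra hE
      simp [fourierState, hE] at h
    simp [hE]
  | succ i ih =>
    obtain ⟨b, -, hb⟩ := Finset.exists_ne_zero_of_sum_ne_zero h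
    have h1 := ih b _ (right_ne_zero_of_mul hb)
    refine (Finset.card_le_card (t := insert b.1 (Finset.univ.filter fun x =>
      Function.update E b.1 (E b.1 - b.2.1) x ≠ 0)) fun x hx => ?_).trans
      ((Finset.card_insert_le _ _).trans (Nat.succ_le_succ h1))
    by_cases hxb : x = b.1
    · simp [hxb]
    · simpa [hxb] using hx

/-- The squared norm of the part of the state with at least `j` collisions. -/
noncomputable def collisionWeight (A : QueryAlgorithm X (AddChar Y ℂ) W) (i j : ℕ) : ℝ :=
  ∑ a, ∑ D : X → Option Y, if HasCollisions D j then ‖A.phaseState i a D‖ ^ 2 else 0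

theorem collisionAmplitude_eq_sqrt (A : QueryAlgorithm X (AddChar Y ℂ) W) (i j : ℕ) :
    A.collisionAmplitude i j = √(A.collisionWeight i j) := by
  unfold collisionAmplitude collisionWeight HasCollisions
  congr!

theorem collisionWeight_nonneg (A : QueryAlgorithm X (AddChar Y ℂ) W) (i j : ℕ) :
    0 ≤ A.collisionWeight i j :=
  Finset.sum_nonneg fun _ _ => Finset.sum_nonneg fun _ _ => by split_ifs <;> positivity

/-- The state of the compressed phase oracle after query number `i + 1`, before the unitary
transformation that follows it. -/
noncomputable def queriedState (A : QueryAlgorithm X (AddChar Y ℂ) W) (i : ℕ)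
    (b : X × AddChar Y ℂ × W) (D : X → Option Y) : ℂ :=
  mixedState (fun E => A.fourierState i b (Function.update E b.1 (E b.1 - b.2.1))) ∅ D

theorem phaseState_succ (A : QueryAlgorithm X (AddChar Y ℂ) W) (i : ℕ)
    (a : X × AddChar Y ℂ × W) (D : X → Option Y) :
    A.phaseState (i + 1) a D
      = (A.U i : Matrix (X × AddChar Y ℂ × W) (X × AddChar Y ℂ × W) ℂ).mulVec
        (fun b => A.queriedState i b D) a := by
  rw [phaseState_eq_mixedState]
  simp only [mixedState, fourierState, compressedQuery, queriedState, Matrix.mulVec, dotProduct,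
    Finset.sum_mul, Finset.mul_sum]
  rw [Finset.sum_comm]
  simp only [mul_assoc]

theorem sum_norm_unitary_mulVec_sq {I : Type*} [Fintype I] [DecidableEq I]
    (U : Matrix.unitaryGroup I ℂ) (z : I → ℂ) :
    ∑ a, ‖(U : Matrix I I ℂ).mulVec z a‖ ^ 2 = ∑ b, ‖z b‖ ^ 2 :=
  sum_norm_mulVec_sq _ (Matrix.mem_unitaryGroup_iff'.1 U.2) z

/-- The unitary acts on the registers and the projection on the database, so they commute and only
the query matters. -/
theorem collisionWeight_succ (A : QueryAlgorithm X (AddChar Y ℂ) W) (i j : ℕ) :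
    A.collisionWeight (i + 1) j = ∑ b, ∑ D : X → Option Y,
      if HasCollisions D j then ‖A.queriedState i b D‖ ^ 2 else 0 := by
  rw [collisionWeight, Finset.sum_comm]
  rw [Finset.sum_comm (s := (Finset.univ : Finset (X × AddChar Y ℂ × W)))]
  refine Finset.sum_congr rfl fun D _ => ?_
  split_ifs
  · simp only [phaseState_succ]
    exact sum_norm_unitary_mulVec_sq _ _
  · simp

theorem sum_phaseState_some (A : QueryAlgorithm X (AddChar Y ℂ) W) (i : ℕ)
    (a : X × AddChar Y ℂ × W) (D : X → Option Y) (x : X) :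
    ∑ y, A.phaseState i a (Function.update D x (some y)) = 0 := by
  simp only [phaseState_eq_mixedState]
  exact sum_mixedState_some _ _ _ _ (Finset.notMem_empty x)

theorem sum_queriedState_some (A : QueryAlgorithm X (AddChar Y ℂ) W) (i : ℕ)
    (a : X × AddChar Y ℂ × W) (D : X → Option Y) (x : X) :
    ∑ y, A.queriedState i a (Function.update D x (some y)) = 0 :=
  sum_mixedState_some _ _ _ _ (Finset.notMem_empty x)

theorem queriedState_update (A : QueryAlgorithm X (AddChar Y ℂ) W) (i : ℕ)
    (b : X × AddChar Y ℂ × W) (D : X → Option Y) (y : Y) :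
    A.queriedState i b (Function.update D b.1 none) / (√(Fintype.card Y) : ℂ)
      + A.queriedState i b (Function.update D b.1 (some y))
    = b.2.1 y * (A.phaseState i b (Function.update D b.1 none) / (√(Fintype.card Y) : ℂ)
      + A.phaseState i b (Function.update D b.1 (some y))) := by
  simp only [phaseState_eq_mixedState]
  exact mixedState_query_some _ D b.1 b.2.1 y

theorem sum_norm_queriedState_sq (A : QueryAlgorithm X (AddChar Y ℂ) W) (i : ℕ)
    (b : X × AddChar Y ℂ × W) (D : X → Option Y) :
    ∑ d, ‖A.queriedState i b (Function.update D b.1 d)‖ ^ 2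
      = ∑ d, ‖A.phaseState i b (Function.update D b.1 d)‖ ^ 2 :=
  sum_norm_query_sq (fun d => A.phaseState i b (Function.update D b.1 d))
    (fun d => A.queriedState i b (Function.update D b.1 d)) b.2.1
    (fun y => b.2.1.norm_apply y) (A.sum_phaseState_some i b D b.1)
    (A.sum_queriedState_some i b D b.1) (A.queriedState_update i b D)

/-- The recursion on a single fibre. If the other entries already contain `j + 1` collisions, the
whole fibre counts and the query is isometric on it; otherwise `sum_norm_query_sq_le` applies to the
set `S` of values completing a collision. -/
theorem sum_collision_queriedState_le (A : QueryAlgorithm X (AddChar Y ℂ) W) (i j : ℕ)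
    (b : X × AddChar Y ℂ × W) (D : X → Option Y) :
    (∑ d, if HasCollisions (Function.update D b.1 d) (j + 1) then
      ‖A.queriedState i b (Function.update D b.1 d)‖ ^ 2 else 0)
    ≤ (√(∑ d, if HasCollisions (Function.update D b.1 d) (j + 1) then
          ‖A.phaseState i b (Function.update D b.1 d)‖ ^ 2 else 0)
      + √(2 * i / Fintype.card Y * ∑ d, if HasCollisions (Function.update D b.1 d) j then
          ‖A.phaseState i b (Function.update D b.1 d)‖ ^ 2 else 0)) ^ 2 := by
  by_cases hn : HasCollisions (Function.update D b.1 none) (j + 1)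
  · simp only [hn.update_of_none, if_true]
    rw [sum_norm_queriedState_sq]
    set t := ∑ d, ‖A.phaseState i b (Function.update D b.1 d)‖ ^ 2 with ht
    have h0 : 0 ≤ t := Finset.sum_nonneg fun _ _ => sq_nonneg _
    refine (Real.sq_sqrt h0).symm.le.trans (pow_le_pow_left₀ (Real.sqrt_nonneg _) ?_ 2)
    exact le_add_of_nonneg_right (Real.sqrt_nonneg _)
  · set S := Finset.univ.filter fun y =>
      HasCollisions (Function.update D b.1 (some y)) (j + 1) with hS
    have hsum : ∀ v : Option Y → ℂ, (∑ d, if HasCollisions (Function.update D b.1 d) (j + 1)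
        then ‖v d‖ ^ 2 else 0) = ∑ y ∈ S, ‖v (some y)‖ ^ 2 := by
      intro v
      rw [hS, Finset.sum_filter, Fintype.sum_option]
      simp only [hn, if_false, zero_add]
    have e1 := hsum fun d => A.queriedState i b (Function.update D b.1 d)
    have e2 := hsum fun d => A.phaseState i b (Function.update D b.1 d)
    beta_reduce at e1 e2
    rw [e1, e2]
    refine (sum_norm_query_sq_le (fun d => A.phaseState i b (Function.update D b.1 d))
      (fun d => A.queriedState i b (Function.update D b.1 d)) b.2.1
      (A.sum_queriedState_some i b D b.1) (A.queriedState_update i b D) S).trans ?_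
    refine pow_le_pow_left₀ (by positivity) (add_le_add_right (Real.sqrt_le_sqrt ?_) _) 2
    -- One value completing `j + 1` collisions shows that every database in the fibre has `j` of
    -- them, so the restricted sum on the right is the full norm. For empty `S` nothing is moved.
    rcases S.eq_empty_or_nonempty with hS0 | ⟨y, hy⟩
    · rw [hS0]
      simp only [Finset.card_empty, Nat.cast_zero, mul_zero, zero_div, zero_mul]
      exact mul_nonneg (by positivity)
        (Finset.sum_nonneg fun _ _ => by split_ifs <;> positivity)
    · simp only [(Finset.mem_filter.1 hy).2.update_succ.1, if_true]
      by_cases hv : ∃ d, A.phaseState i b (Function.update D b.1 d) ≠ 0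
      · obtain ⟨d, hd⟩ := hv
        rw [phaseState_eq_mixedState] at hd
        have hc : S.card ≤ i := card_collision_values_le (mixedState_empty_ne_zero
          (A.card_support_le_of_fourierState_ne_zero i b) _ hd) hn
        have hc' : (S.card : ℝ) ≤ i := by exact_mod_cast hc
        refine mul_le_mul_of_nonneg_right ?_ (Finset.sum_nonneg fun _ _ => sq_nonneg _)
        exact div_le_div_of_nonneg_right (by linarith) (Nat.cast_nonneg _)
      · push Not at hv
        simp [hv]

theorem collisionWeight_succ_succ_le (A : QueryAlgorithm X (AddChar Y ℂ) W) (i j : ℕ) :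
    A.collisionWeight (i + 1) (j + 1) ≤ (√(A.collisionWeight i (j + 1))
      + √(2 * i / Fintype.card Y * A.collisionWeight i j)) ^ 2 := by
  have hM : (0 : ℝ) < Fintype.card (Option Y) := by exact_mod_cast Fintype.card_pos
  set M : ℝ := ((Fintype.card (Option Y) : ℕ) : ℝ) with hMdef
  -- Every database lies on fibres counted `M` times in total; this common factor cancels at the
  -- end.
  have avg : ∀ (F : X × AddChar Y ℂ × W → (X → Option Y) → ℝ),
      M * ∑ b, ∑ D, F b D
        = ∑ q : (X × AddChar Y ℂ × W) × (X → Option Y),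
          ∑ d, F q.1 (Function.update q.2 q.1.1 d) := by
    intro F
    rw [Fintype.sum_prod_type (γ := ℝ) (f := fun q : (X × AddChar Y ℂ × W) × (X → Option Y) =>
      ∑ d, F q.1 (Function.update q.2 q.1.1 d)), Finset.mul_sum]
    refine Finset.sum_congr rfl fun b _ => ?_
    rw [hMdef, ← nsmul_eq_mul, ← sum_update_eq b.1 (F b)]
  have h0 : ∀ (k : ℕ) (q : (X × AddChar Y ℂ × W) × (X → Option Y)),
      (0 : ℝ) ≤ ∑ d, if HasCollisions (Function.update q.2 q.1.1 d) k then
          ‖A.phaseState i q.1 (Function.update q.2 q.1.1 d)‖ ^ 2 else 0 := fun k q =>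
    Finset.sum_nonneg fun _ _ => by split_ifs <;> positivity
  have hc : (0 : ℝ) ≤ 2 * i / Fintype.card Y := by positivity
  have key : M * A.collisionWeight (i + 1) (j + 1)
      ≤ (√(M * A.collisionWeight i (j + 1))
        + √(2 * i / Fintype.card Y * (M * A.collisionWeight i j))) ^ 2 := by
    rw [collisionWeight_succ, avg, collisionWeight, avg, collisionWeight, avg]
    refine (Finset.sum_le_sum fun q _ =>
      A.sum_collision_queriedState_le i j q.1 q.2).trans ?_
    rw [Finset.mul_sum]
    exact sum_sqrt_add_sqrt_sq_le _ _ _ (h0 (j + 1)) fun q => mul_nonneg hc (h0 j q)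
  have hr : √(M * A.collisionWeight i (j + 1))
        + √(2 * i / Fintype.card Y * (M * A.collisionWeight i j))
      = √M * (√(A.collisionWeight i (j + 1))
        + √(2 * i / Fintype.card Y * A.collisionWeight i j)) := by
    rw [mul_left_comm, Real.sqrt_mul hM.le, Real.sqrt_mul hM.le]
    ring
  rw [hr, mul_pow, Real.sq_sqrt hM.le] at key
  exact le_of_mul_le_mul_left key hM

theorem collisionAmplitude_succ_succ_le (A : QueryAlgorithm X (AddChar Y ℂ) W) (i j : ℕ) :
    A.collisionAmplitude (i + 1) (j + 1) ≤ A.collisionAmplitude i (j + 1)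
      + √(2 * i / Fintype.card Y) * A.collisionAmplitude i j := by
  simp only [collisionAmplitude_eq_sqrt]
  rw [← Real.sqrt_mul (by positivity)]
  exact Real.sqrt_le_iff.2 ⟨by positivity, A.collisionWeight_succ_succ_le i j⟩

theorem phaseState_zero (A : QueryAlgorithm X (AddChar Y ℂ) W) (a : X × AddChar Y ℂ × W)
    (D : X → Option Y) : A.phaseState 0 a D = if D = fun _ => none then A.init a else 0 := by
  have h1 : A.phaseState 0 a D
      = A.init a * ∏ x, entryAmplitude ((0 : X → AddChar Y ℂ) x) (D x) := by
    rw [phaseState, Finset.sum_eq_single 0]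
    · simp [fourierState]
    · intro E _ hE; simp [fourierState, hE]
    · simp
  rw [h1]
  split_ifs with hD
  · simp [hD, entryAmplitude]
  · obtain ⟨x, hx⟩ := Function.ne_iff.1 hD
    obtain ⟨y, hy⟩ := Option.ne_none_iff_exists'.1 hx
    rw [Finset.prod_eq_zero (Finset.mem_univ x), mul_zero]
    simp [entryAmplitude, hy]

/-- With no collision required, the weight is the total squared norm, which queries preserve fibre
by fibre. -/
theorem collisionWeight_zero_right (A : QueryAlgorithm X (AddChar Y ℂ) W) (i : ℕ) :
    A.collisionWeight i 0 = 1 := by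
  induction i with
  | zero =>
    simp only [collisionWeight, HasCollisions.zero, if_true, phaseState_zero]
    rw [← A.init_norm]
    refine Finset.sum_congr rfl fun a _ => ?_
    rw [Finset.sum_eq_single (fun _ => none)] <;> simp +contextual
  | succ i ih =>
    rw [← ih, collisionWeight_succ, collisionWeight]
    refine Finset.sum_congr rfl fun b _ => ?_
    simp only [HasCollisions.zero, if_true]
    have hM : (Fintype.card (Option Y) : ℝ) ≠ 0 := by exact_mod_cast Fintype.card_ne_zero
    refine mul_left_cancel₀ hM ?_
    rw [← nsmul_eq_mul, ← nsmul_eq_mul, ← sum_update_eq b.1, ← sum_update_eq b.1]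
    exact Finset.sum_congr rfl fun D _ => A.sum_norm_queriedState_sq i b D

theorem collisionAmplitude_zero_left (A : QueryAlgorithm X (AddChar Y ℂ) W) (j : ℕ) :
    A.collisionAmplitude 0 (j + 1) = 0 := by
  rw [collisionAmplitude_eq_sqrt, Real.sqrt_eq_zero (A.collisionWeight_nonneg _ _)]
  refine Finset.sum_eq_zero fun a _ => Finset.sum_eq_zero fun D _ => ?_
  rw [phaseState_zero]
  by_cases hD : D = fun _ => none
  · rw [if_neg]
    rintro ⟨p, hp⟩
    obtain ⟨-, y, h, -⟩ := hp.1 0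
    simp [hD] at h
  · simp [hD]

/-! ### Solving the recursion -/

/-- The convex power lies above its tangent at `a`, by Bernoulli's inequality. With `a` and `b` the
values of `i^(3/2)/√N` before and after a query, this is the induction step of
`collisionAmplitude_le`. -/
theorem pow_div_factorial_add_le {a b : ℝ} (ha : 0 ≤ a) (hab : a ≤ b) (j : ℕ) :
    a ^ (j + 1) / (j + 1).factorial + (b - a) * (a ^ j / j.factorial)
      ≤ b ^ (j + 1) / (j + 1).factorial := by
  have hj : (0 : ℝ) < j.factorial := by exact_mod_cast j.factorial_pos
  have h1 : a ^ (j + 1) + (j + 1) * a ^ j * (b - a) ≤ b ^ (j + 1) := by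
    rcases ha.eq_or_lt with rfl | ha
    · rcases j.eq_zero_or_pos with rfl | hj0
      · simp
      · rw [zero_pow (by omega), zero_pow (by omega)]
        simp only [mul_zero, zero_mul, add_zero]
        positivity
    · have h2 : 1 + ((j + 1 : ℕ) : ℝ) * ((b - a) / a) ≤ (1 + (b - a) / a) ^ (j + 1) :=
        one_add_mul_le_pow (by have : 0 ≤ (b - a) / a := div_nonneg (by linarith) ha.le
                               linarith) _
      have h3 : 1 + (b - a) / a = b / a := by field_simp; ring
      rw [h3, div_pow, le_div_iff₀ (by positivity)] at h2
      refine le_trans (le_of_eq ?_) h2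
      push_cast
      field_simp
      ring
  rw [Nat.factorial_succ, Nat.cast_mul]
  have e : a ^ (j + 1) / (((j + 1 : ℕ) : ℝ) * j.factorial) + (b - a) * (a ^ j / j.factorial)
      = (a ^ (j + 1) + (j + 1) * a ^ j * (b - a)) / (((j + 1 : ℕ) : ℝ) * j.factorial) := by
    push_cast
    field_simp
  rw [e]
  gcongr

/-- The slope of `x^(3/2)` on `[i, i+1]` is at least `(3/2)√i`, and `√2 ≤ 3/2`. Algebraically, `t² -
s² = 1` gives `t³ - s³ = (t² + ts + s²)/(t + s) ≥ (3/2)s`. -/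
theorem sqrt_two_mul_le_rpow_sub (i : ℕ) :
    √(2 * (i : ℝ)) ≤ ((i + 1 : ℕ) : ℝ) ^ (3 / 2 : ℝ) - (i : ℝ) ^ (3 / 2 : ℝ) := by
  have h : ∀ n : ℕ, (n : ℝ) ^ (3 / 2 : ℝ) = n * √n := by
    intro n
    rw [show (3 / 2 : ℝ) = 1 + 1 / 2 by norm_num,
      Real.rpow_add_of_nonneg n.cast_nonneg (by norm_num) (by norm_num), Real.rpow_one,
      Real.sqrt_eq_rpow]
  rw [h, h, Real.sqrt_mul (by norm_num)]
  push_cast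
  set s := √(i : ℝ) with hs
  set t := √((i : ℝ) + 1) with ht
  have hs2 : s ^ 2 = i := Real.sq_sqrt i.cast_nonneg
  have ht2 : t ^ 2 = i + 1 := Real.sq_sqrt (by positivity)
  have hs0 : 0 ≤ s := Real.sqrt_nonneg _
  have ht0 : 0 < t := Real.sqrt_pos.2 (by positivity)
  have h2 : √(2 : ℝ) ≤ 3 / 2 := Real.sqrt_le_iff.2 ⟨by norm_num, by norm_num⟩
  have hst : s ≤ t := Real.sqrt_le_sqrt (by linarith)
  have h3 : √2 * s ≤ 3 / 2 * s := by gcongr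
  have h4 : ((i : ℝ) + 1) * t - i * s = (t - s) * (t ^ 2 + t * s + s ^ 2) := by
    rw [← ht2, ← hs2]; ring
  rw [h4]
  refine h3.trans ?_
  have h5 : (t - s) * (t + s) = 1 := by nlinarith
  have h6 : 3 / 2 * s * (t + s) ≤ t ^ 2 + t * s + s ^ 2 := by nlinarith [sq_nonneg (t - s)]
  have h7 : 0 ≤ t - s := by linarith
  calc 3 / 2 * s = (t - s) * (3 / 2 * s * (t + s)) := by linear_combination -(3 / 2 * s) * h5
    _ ≤ _ := mul_le_mul_of_nonneg_left h6 h7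

theorem collisionAmplitude_le (A : QueryAlgorithm X (AddChar Y ℂ) W) (i j : ℕ) :
    A.collisionAmplitude i j
      ≤ ((i : ℝ) ^ (3 / 2 : ℝ) / √(Fintype.card Y)) ^ j / j.factorial := by
  induction i generalizing j with
  | zero =>
    rcases j with _ | j
    · simp [collisionAmplitude_eq_sqrt, collisionWeight_zero_right]
    · rw [collisionAmplitude_zero_left]; positivity
  | succ i ih =>
    rcases j with _ | j
    · simp [collisionAmplitude_eq_sqrt, collisionWeight_zero_right]
    · refine (A.collisionAmplitude_succ_succ_le i j).trans ?_
      have hle := sqrt_two_mul_le_rpow_sub i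
      refine le_trans ?_ (pow_div_factorial_add_le
        (a := (i : ℝ) ^ (3 / 2 : ℝ) / √(Fintype.card Y)) (by positivity) ?_ j)
      · refine add_le_add (ih _) (mul_le_mul ?_ (ih _) (Real.sqrt_nonneg _) ?_)
        · rw [Real.sqrt_div (by positivity), ← sub_div]
          gcongr
        · rw [← sub_div]
          exact div_nonneg ((Real.sqrt_nonneg _).trans hle) (Real.sqrt_nonneg _)
      · gcongr
        simp

/-- `j^j/j!` is one term of the series of `e^j`; the following term makes the inequality strict. -/
theorem pow_self_lt_exp_mul_factorial {j : ℕ} (hj1 : 1 ≤ j) :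
    (j : ℝ) ^ j < Real.exp 1 ^ j * j.factorial := by
  have hj : (0 : ℝ) < j.factorial := by exact_mod_cast j.factorial_pos
  have h := Real.sum_le_exp_of_nonneg (x := (j : ℝ)) j.cast_nonneg (j + 2)
  rw [← Real.exp_nat_mul, mul_one, ← div_lt_iff₀ hj]
  refine lt_of_lt_of_le ?_ h
  rw [Finset.sum_range_succ, Finset.sum_range_succ]
  have : 0 ≤ ∑ m ∈ Finset.range j, (j : ℝ) ^ m / m.factorial := by positivity
  have : 0 < (j : ℝ) ^ (j + 1) / (j + 1).factorial := by positivity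
  linarith

end QueryAlgorithm

/-! ### The cost of decompressing the announced collisions -/

section Decompression

open scoped Classical

variable {X Y : Type*}

/-- The function `F` does not depend on the entry at `x`. -/
def IndepOf (F : (X → Option Y) → ℝ) (x : X) : Prop :=
  ∀ D d, F (Function.update D x d) = F D

theorem IndepOf.mul {F G : (X → Option Y) → ℝ} {x : X} (hF : IndepOf F x) (hG : IndepOf G x) :
    IndepOf (fun D => F D * G D) x := fun D d => by simp only [hF D d, hG D d]

theorem IndepOf.prod {ι : Type*} {t : Finset ι} {F : ι → (X → Option Y) → ℝ} {x : X}
    (hF : ∀ k ∈ t, IndepOf (F k) x) : IndepOf (fun D => ∏ k ∈ t, F k D) x :=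
  fun D d => Finset.prod_congr rfl fun k hk => hF k hk D d

/-- The pair of inputs is a collision of `D`. -/
def Collides (D : X → Option Y) (q : X × X) : Prop :=
  ∃ y : Y, D q.1 = some y ∧ D q.2 = some y

theorem indepOf_collides {q : X × X} {x : X} (h1 : x ≠ q.1) (h2 : x ≠ q.2) (a b : ℝ) :
    IndepOf (fun D : X → Option Y => if Collides D q then a else b) x := by
  intro D d
  have h : Collides (Function.update D x d) q ↔ Collides D q := by
    simp [Collides, h1.symm, h2.symm]
  simp only [h]

variable [Fintype Y]

/-- A pigeonhole argument with threshold `⌈j/2⌉`: if fewer pairs than that collide in `D`, at least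
that many do not, and each of these contributes `1/N`. -/
theorem prod_collides_le [Nonempty Y] {j : ℕ} (p : Fin j → X × X) (hne : ∀ k, (p k).1 ≠ (p k).2)
    (hdisj : ∀ k l, k ≠ l → Disjoint ({(p k).1, (p k).2} : Set X) {(p l).1, (p l).2})
    (D : X → Option Y) :
    (∏ k, if Collides D (p k) then (4 : ℝ) else 4 / Fintype.card Y)
      ≤ 4 ^ j * ((if HasCollisions D ((j + 1) / 2) then 1 else 0)
        + (1 / Fintype.card Y) ^ ((j + 1) / 2)) := by
  have hN1 : (1 : ℝ) ≤ Fintype.card Y := by exact_mod_cast Fintype.card_pos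
  set N : ℝ := ((Fintype.card Y : ℕ) : ℝ) with hNdef
  have hinv0 : 0 ≤ 1 / N := by positivity
  have hinv1 : 1 / N ≤ 1 := by rw [div_le_one (by linarith)]; exact hN1
  set C := Finset.univ.filter fun k => Collides D (p k) with hC
  set C' := Finset.univ.filter fun k => ¬ Collides D (p k) with hC'
  have hcard : C.card + C'.card = j := by
    rw [hC, hC', Finset.card_filter_add_card_filter_not, Finset.card_univ, Fintype.card_fin]
  have hprod : (∏ k, if Collides D (p k) then (4 : ℝ) else 4 / N) = 4 ^ j * (1 / N) ^ C'.card := by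
    have : ∀ k, (if Collides D (p k) then (4 : ℝ) else 4 / N)
        = 4 * if Collides D (p k) then 1 else 1 / N := by
      intro k; split_ifs <;> ring
    simp only [this]
    rw [Finset.prod_mul_distrib, Finset.prod_const, Finset.card_univ, Fintype.card_fin,
      Finset.prod_ite, Finset.prod_const_one, Finset.prod_const, one_mul]
  rw [hprod]
  refine mul_le_mul_of_nonneg_left ?_ (by positivity)
  split_ifs with h
  · exact (pow_le_one₀ hinv0 hinv1).trans (le_add_of_nonneg_right (by positivity))
  · rw [zero_add]
    refine pow_le_pow_of_le_one hinv0 hinv1 ?_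
    have hlt : C.card < (j + 1) / 2 := by
      by_contra hge
      push Not at hge
      refine h ⟨p ∘ fun k => C.equivFin.symm (Fin.castLE hge k), fun k => ⟨hne _, ?_⟩,
        fun k l hkl => hdisj _ _ ?_⟩
      · exact (Finset.mem_filter.1 (C.equivFin.symm (Fin.castLE hge k)).2).2
      · intro e
        exact hkl (Fin.castLE_injective hge (C.equivFin.symm.injective (Subtype.ext e)))
    omega

variable [Fintype X]

theorem norm_div_sqrt_card_sq (a : ℂ) :
    ‖a / (√(Fintype.card Y) : ℂ)‖ ^ 2 = ‖a‖ ^ 2 / Fintype.card Y := by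
  rw [norm_div, div_pow, Complex.norm_real, Real.norm_of_nonneg (Real.sqrt_nonneg _),
    Real.sq_sqrt (Nat.cast_nonneg _)]

theorem norm_add_four_sq_le (a b c d : ℂ) :
    ‖a + b + (c + d)‖ ^ 2 ≤ 4 * (‖a‖ ^ 2 + ‖b‖ ^ 2 + ‖c‖ ^ 2 + ‖d‖ ^ 2) := by
  have h : ‖a + b + (c + d)‖ ≤ ‖a‖ + ‖b‖ + (‖c‖ + ‖d‖) :=
    (norm_add_le _ _).trans (add_le_add (norm_add_le _ _) (norm_add_le _ _))
  refine (pow_le_pow_left₀ (norm_nonneg _) h 2).trans ?_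
  nlinarith [sq_nonneg (‖a‖ - ‖b‖), sq_nonneg (‖a‖ - ‖c‖), sq_nonneg (‖a‖ - ‖d‖),
    sq_nonneg (‖b‖ - ‖c‖), sq_nonneg (‖b‖ - ‖d‖), sq_nonneg (‖c‖ - ‖d‖)]

/-- A decompressed collision at `y` receives amplitude from four compressed databases, with
coefficients `1/N`, `1/√N`, `1/√N` and 1 according to which of the two entries are missing.
Cauchy–Schwarz costs the factor 4. Summing over `y` counts the doubly missing term `N` times, which
turns its weight `4/N²` into `4/N`. -/
theorem sum_norm_decompress_diag_sq_le [Nonempty Y] (f : Option Y → Option Y → ℂ) :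
    ∑ y, ‖(f none none / (√(Fintype.card Y) : ℂ) + f (some y) none) / (√(Fintype.card Y) : ℂ)
        + (f none (some y) / (√(Fintype.card Y) : ℂ) + f (some y) (some y))‖ ^ 2
      ≤ ∑ d, ∑ d', (if ∃ y, d = some y ∧ d' = some y then (4 : ℝ) else 4 / Fintype.card Y)
        * ‖f d d'‖ ^ 2 := by
  have hN : (0 : ℝ) < Fintype.card Y := by exact_mod_cast Fintype.card_pos
  have hN1 : (1 : ℝ) ≤ Fintype.card Y := by exact_mod_cast Fintype.card_pos
  set N : ℝ := ((Fintype.card Y : ℕ) : ℝ) with hNdef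
  have hdiag : ∀ y : Y, 4 * ‖f (some y) (some y)‖ ^ 2
      ≤ ∑ y', (if y = y' then (4 : ℝ) else 4 / N) * ‖f (some y) (some y')‖ ^ 2 := by
    intro y
    refine le_trans (le_of_eq ?_) (Finset.single_le_sum (fun y' _ => ?_) (Finset.mem_univ y))
    · simp
    · split_ifs <;> positivity
  calc _ ≤ ∑ y, 4 * (‖f none none‖ ^ 2 / N / N + ‖f (some y) none‖ ^ 2 / N
          + ‖f none (some y)‖ ^ 2 / N + ‖f (some y) (some y)‖ ^ 2) := by
        refine Finset.sum_le_sum fun y _ => ?_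
        rw [add_div]
        refine (norm_add_four_sq_le _ _ _ _).trans (le_of_eq ?_)
        simp only [norm_div_sqrt_card_sq, hNdef]
    _ = 4 / N * ‖f none none‖ ^ 2 + ∑ y, 4 / N * ‖f none (some y)‖ ^ 2
          + (∑ y, 4 / N * ‖f (some y) none‖ ^ 2 + ∑ y, 4 * ‖f (some y) (some y)‖ ^ 2) := by
        simp only [← Finset.mul_sum, Finset.sum_add_distrib, ← Finset.sum_div, Finset.sum_const,
          Finset.card_univ, nsmul_eq_mul, ← hNdef]
        field_simp
        ring
    _ ≤ _ := by
        simp only [Fintype.sum_option, Finset.sum_add_distrib]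
        simp only [reduceCtorEq, false_and, and_false, exists_false, if_false, Option.some.injEq,
          exists_eq_left']
        have := Finset.sum_le_sum fun y (_ : y ∈ Finset.univ) => hdiag y
        simp only [eq_comm] at this ⊢
        linarith

variable [AddCommGroup Y]

theorem sum_mixedState_insert_sq (g : (X → AddChar Y ℂ) → ℂ) (s : Finset X)
    (F : (X → Option Y) → ℝ) (x : X) (hx : x ∉ s) (hF : IndepOf F x) :
    ∑ D, F D * ‖mixedState g (insert x s) D‖ ^ 2 = ∑ D, F D * ‖mixedState g s D‖ ^ 2 := by
  have hM : (Fintype.card (Option Y) : ℝ) ≠ 0 := by exact_mod_cast Fintype.card_ne_zero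
  refine mul_left_cancel₀ hM ?_
  rw [← nsmul_eq_mul, ← nsmul_eq_mul, ← sum_update_eq x, ← sum_update_eq x]
  refine Finset.sum_congr rfl fun D _ => ?_
  simp only [hF D, ← Finset.mul_sum]
  congr 1
  rw [← sum_norm_uniform_add_sq (fun d => mixedState g s (Function.update D x d))
    (sum_mixedState_some g s D x hx), Fintype.sum_option, mixedState_insert_none]
  simp [mixedState_insert_some g s D x hx]

theorem sum_mixedState_union_sq (g : (X → AddChar Y ℂ) → ℂ) (s r : Finset X)
    (F : (X → Option Y) → ℝ) (hr : Disjoint r s) (hF : ∀ x ∈ r, IndepOf F x) :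
    ∑ D, F D * ‖mixedState g (r ∪ s) D‖ ^ 2 = ∑ D, F D * ‖mixedState g s D‖ ^ 2 := by
  induction r using Finset.induction_on with
  | empty => simp
  | insert x r hx ih =>
    rw [Finset.disjoint_insert_left] at hr
    rw [Finset.insert_union, sum_mixedState_insert_sq, ih hr.2]
    · exact fun z hz => hF z (Finset.mem_insert_of_mem hz)
    · simp [hx, hr.1]
    · exact hF x (Finset.mem_insert_self x r)

theorem mixedState_insert_insert_some (g : (X → AddChar Y ℂ) → ℂ) (s : Finset X) (x x' : X)
    (hxx' : x ≠ x') (hx : x ∉ s) (hx' : x' ∉ s) (D : X → Option Y) (y y' : Y) :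
    mixedState g (insert x' (insert x s)) (Function.update (Function.update D x (some y)) x'
        (some y'))
      = (mixedState g s (Function.update (Function.update D x none) x' none)
            / (√(Fintype.card Y) : ℂ)
          + mixedState g s (Function.update (Function.update D x (some y)) x' none))
          / (√(Fintype.card Y) : ℂ)
        + (mixedState g s (Function.update (Function.update D x none) x' (some y'))
            / (√(Fintype.card Y) : ℂ)
          + mixedState g s (Function.update (Function.update D x (some y)) x' (some y'))) := by
  rw [mixedState_insert_some _ _ _ _ (by simp [hxx'.symm, hx'])]
  simp only [Function.update_comm hxx']
  rw [mixedState_insert_some _ _ _ _ hx, mixedState_insert_some _ _ _ _ hx]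

theorem sum_collides_mixedState_insert_le (g : (X → AddChar Y ℂ) → ℂ) (s : Finset X)
    (F : (X → Option Y) → ℝ) (q : X × X) (hq : q.1 ≠ q.2) (h1 : q.1 ∉ s) (h2 : q.2 ∉ s)
    (hF0 : ∀ D, 0 ≤ F D) (hF1 : IndepOf F q.1) (hF2 : IndepOf F q.2) :
    ∑ D, F D * (if Collides D q then ‖mixedState g (insert q.2 (insert q.1 s)) D‖ ^ 2 else 0)
      ≤ ∑ D, F D * ((if Collides D q then (4 : ℝ) else 4 / Fintype.card Y)
        * ‖mixedState g s D‖ ^ 2) := by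
  have hM : (0 : ℝ) < Fintype.card (Option Y) := by exact_mod_cast Fintype.card_pos
  refine le_of_mul_le_mul_left (le_of_mul_le_mul_left ?_ hM) hM
  have avg : ∀ G : (X → Option Y) → ℝ,
      (Fintype.card (Option Y) : ℝ) * ((Fintype.card (Option Y) : ℝ) * ∑ D, G D)
        = ∑ D, ∑ d, ∑ d', G (Function.update (Function.update D q.1 d) q.2 d') := by
    intro G
    rw [← nsmul_eq_mul, ← nsmul_eq_mul, ← sum_update_eq q.2,
      ← sum_update_eq q.1 fun D => ∑ d', G (Function.update D q.2 d')]
  rw [avg, avg]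
  refine Finset.sum_le_sum fun D _ => ?_
  simp only [hF1 _, hF2 _, ← Finset.mul_sum]
  refine mul_le_mul_of_nonneg_left ?_ (hF0 D)
  have hc : ∀ d d', Collides (Function.update (Function.update D q.1 d) q.2 d') q
      ↔ ∃ y, d = some y ∧ d' = some y := by
    intro d d'
    simp [Collides, hq]
  simp only [hc]
  refine le_trans (le_of_eq ?_) (sum_norm_decompress_diag_sq_le fun d d' =>
    mixedState g s (Function.update (Function.update D q.1 d) q.2 d'))
  simp only [Fintype.sum_option, reduceCtorEq, false_and, and_false, exists_false, if_false,
    Option.some.injEq, exists_eq_left', Finset.sum_const_zero, zero_add]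
  refine Finset.sum_congr rfl fun y _ => ?_
  rw [Finset.sum_eq_single y]
  · simp only [if_true, mixedState_insert_insert_some g s q.1 q.2 hq h1 h2]
  · intro y' _ hy'; simp [hy']
  · simp

/-- The inputs that occur in the listed pairs. -/
noncomputable def inputsOf {j : ℕ} (p : Fin j → X × X) (t : Finset (Fin j)) : Finset X :=
  t.biUnion fun k => {(p k).1, (p k).2}

/-- The pairs are compressed back one at a time. The weight `F` is arbitrary so that it can absorb
the factors of pairs already treated; disjointness keeps it independent of the entries still
decompressed. -/
theorem sum_collides_mixedState_inputsOf_le (g : (X → AddChar Y ℂ) → ℂ) {j : ℕ}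
    (p : Fin j → X × X) (hne : ∀ k, (p k).1 ≠ (p k).2)
    (hdisj : ∀ k l, k ≠ l → Disjoint ({(p k).1, (p k).2} : Set X) {(p l).1, (p l).2})
    (t : Finset (Fin j)) (F : (X → Option Y) → ℝ) (hF0 : ∀ D, 0 ≤ F D)
    (hF : ∀ x ∈ inputsOf p t, IndepOf F x) :
    ∑ D, F D * ((∏ k ∈ t, if Collides D (p k) then (1 : ℝ) else 0)
        * ‖mixedState g (inputsOf p t) D‖ ^ 2)
      ≤ ∑ D, F D * ((∏ k ∈ t, if Collides D (p k) then (4 : ℝ) else 4 / Fintype.card Y)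
        * ‖mixedState g ∅ D‖ ^ 2) := by
  induction t using Finset.induction_on generalizing F with
  | empty => simp [inputsOf]
  | insert k t hk ih =>
    have hins : inputsOf p (insert k t)
        = insert (p k).2 (insert (p k).1 (inputsOf p t)) := by
      simp only [inputsOf, Finset.biUnion_insert]
      ext z
      simp only [Finset.mem_union, Finset.mem_insert, Finset.mem_singleton]
      tauto
    have hpair : ∀ l ∈ t, (p k).1 ≠ (p l).1 ∧ (p k).1 ≠ (p l).2 ∧ (p k).2 ≠ (p l).1
        ∧ (p k).2 ≠ (p l).2 := by
      intro l hl
      have := hdisj k l (fun e => hk (e ▸ hl))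
      simp only [Set.disjoint_insert_left, Set.mem_insert_iff, Set.mem_singleton_iff, not_or,
        Set.disjoint_singleton_left] at this
      tauto
    have hn1 : (p k).1 ∉ inputsOf p t := by
      simp only [inputsOf, Finset.mem_biUnion, Finset.mem_insert, Finset.mem_singleton, not_exists,
        not_and, not_or]
      exact fun l hl => ⟨(hpair l hl).1, (hpair l hl).2.1⟩
    have hn2 : (p k).2 ∉ inputsOf p t := by
      simp only [inputsOf, Finset.mem_biUnion, Finset.mem_insert, Finset.mem_singleton, not_exists,
        not_and, not_or]
      exact fun l hl => (hpair l hl).2.2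
    have hF1 : IndepOf F (p k).1 := hF _ (by simp [hins])
    have hF2 : IndepOf F (p k).2 := hF _ (by simp [hins])
    have hstep := sum_collides_mixedState_insert_le g (inputsOf p t)
      (fun D => F D * ∏ l ∈ t, if Collides D (p l) then (1 : ℝ) else 0) (p k) (hne k) hn1 hn2
      (fun D => mul_nonneg (hF0 D) (Finset.prod_nonneg fun l _ => by split_ifs <;> norm_num))
      (hF1.mul (IndepOf.prod fun l hl => indepOf_collides (hpair l hl).1 (hpair l hl).2.1 _ _))
      (hF2.mul (IndepOf.prod fun l hl =>
        indepOf_collides (hpair l hl).2.2.1 (hpair l hl).2.2.2 _ _))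
    have hih := ih (fun D => F D * if Collides D (p k) then (4 : ℝ) else 4 / Fintype.card Y)
      (fun D => mul_nonneg (hF0 D) (by split_ifs <;> positivity)) (fun x hx => by
        refine (hF x ?_).mul (indepOf_collides (fun e => hn1 (e ▸ hx)) (fun e => hn2 (e ▸ hx)) _ _)
        simp [hins, hx])
    refine le_trans (le_of_eq ?_) ((hstep.trans (le_of_eq ?_)).trans (hih.trans (le_of_eq ?_)))
    · refine Finset.sum_congr rfl fun D _ => ?_
      rw [hins, Finset.prod_insert hk]
      split_ifs <;> ring
    · refine Finset.sum_congr rfl fun D _ => ?_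
      ring
    · refine Finset.sum_congr rfl fun D _ => ?_
      rw [Finset.prod_insert hk]
      ring

theorem sum_isCollisionList_mixedState_univ_le (g : (X → AddChar Y ℂ) → ℂ) {j : ℕ}
    (p : Fin j → X × X) :
    (∑ D : X → Option Y, if IsCollisionList D p then ‖mixedState g Finset.univ D‖ ^ 2 else 0)
      ≤ 4 ^ j * ((∑ D : X → Option Y, if HasCollisions D ((j + 1) / 2)
          then ‖mixedState g ∅ D‖ ^ 2 else 0)
        + (1 / Fintype.card Y) ^ ((j + 1) / 2) * ∑ D : X → Option Y, ‖mixedState g ∅ D‖ ^ 2) := by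
  -- An output that is not a list of disjoint proper pairs never succeeds, so the left side is zero.
  by_cases hp : (∀ k, (p k).1 ≠ (p k).2) ∧
      ∀ k l, k ≠ l → Disjoint ({(p k).1, (p k).2} : Set X) {(p l).1, (p l).2}
  · obtain ⟨hne, hdisj⟩ := hp
    set s := inputsOf p Finset.univ with hs
    have hcol : ∀ D : X → Option Y, (if IsCollisionList D p then ‖mixedState g Finset.univ D‖ ^ 2
        else 0) = (∏ k, if Collides D (p k) then (1 : ℝ) else 0)
          * ‖mixedState g (sᶜ ∪ s) D‖ ^ 2 := by
      intro D
      rw [Finset.union_comm, Finset.union_compl]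
      by_cases h : IsCollisionList D p
      · rw [if_pos h, Finset.prod_eq_one, one_mul]
        exact fun k _ => if_pos (h.1 k).2
      · rw [if_neg h]
        have : ∃ k, ¬ Collides D (p k) := by
          by_contra hall
          push Not at hall
          exact h ⟨fun k => ⟨hne k, hall k⟩, hdisj⟩
        obtain ⟨k, hk⟩ := this
        rw [Finset.prod_eq_zero (Finset.mem_univ k) (if_neg hk), zero_mul]
    simp only [hcol]
    -- Success depends only on the listed inputs, so all other entries may be left compressed.
    rw [sum_mixedState_union_sq g s sᶜ _ (disjoint_compl_left) fun x hx =>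
      IndepOf.prod fun k _ => indepOf_collides (fun e => Finset.mem_compl.1 hx ?_)
        (fun e => Finset.mem_compl.1 hx ?_) _ _]
    · have h := sum_collides_mixedState_inputsOf_le g p hne hdisj Finset.univ (fun _ => 1)
        (fun _ => zero_le_one) (fun _ _ _ _ => rfl)
      simp only [one_mul] at h
      refine h.trans ?_
      rw [Finset.mul_sum, ← Finset.sum_add_distrib, Finset.mul_sum]
      refine Finset.sum_le_sum fun D _ => ?_
      refine (mul_le_mul_of_nonneg_right (prod_collides_le p hne hdisj D) (sq_nonneg _)).trans
        (le_of_eq ?_)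
      split_ifs <;> ring
    · exact Finset.mem_biUnion.2 ⟨k, Finset.mem_univ k, by simp [e]⟩
    · exact Finset.mem_biUnion.2 ⟨k, Finset.mem_univ k, by simp [e]⟩
  · have h0 : ∀ D : X → Option Y, ¬ IsCollisionList D p := fun D h =>
      hp ⟨fun k => (h.1 k).1, h.2⟩
    simp only [h0, if_false, Finset.sum_const_zero]
    have : 0 ≤ ∑ D : X → Option Y, if HasCollisions D ((j + 1) / 2)
        then ‖mixedState g ∅ D‖ ^ 2 else 0 :=
      Finset.sum_nonneg fun _ _ => by split_ifs <;> positivity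
    positivity

end Decompression

/-! ### From the standard oracle to the compressed oracle -/

section CharacterTransform

open scoped Classical Kronecker

theorem sqrt_card_mul_self (Y : Type*) [Fintype Y] :
    (√(Fintype.card Y) : ℂ) * (√(Fintype.card Y) : ℂ)
      = Fintype.card Y := by
  rw [← Complex.ofReal_mul, Real.mul_self_sqrt (Nat.cast_nonneg _), Complex.ofReal_natCast]

variable {X Y W : Type*} [Fintype X] [Fintype Y] [Fintype W] [AddCommGroup Y]

/-- The character transform of the response register. -/
noncomputable def characterMatrix (Y : Type*) [Fintype Y] [AddCommGroup Y] :
    Matrix (AddChar Y ℂ) Y ℂ :=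
  fun u r => u r / (√(Fintype.card Y) : ℂ)

theorem conjTranspose_characterMatrix_mul_self :
    (characterMatrix Y).conjTranspose * characterMatrix Y = 1 := by
  have hN : (Fintype.card Y : ℂ) ≠ 0 := by exact_mod_cast Fintype.card_ne_zero
  ext r r'
  have h : ∀ u : AddChar Y ℂ, star (u r / (√(Fintype.card Y) : ℂ))
      * (u r' / (√(Fintype.card Y) : ℂ)) = u (r' - r) / Fintype.card Y := by
    intro u
    rw [star_div₀, ← sqrt_card_mul_self Y, sub_eq_add_neg, AddChar.map_add_eq_mul,
      AddChar.map_neg_eq_conj]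
    simp only [RCLike.star_def, Complex.conj_ofReal]
    ring
  simp only [Matrix.mul_apply, Matrix.conjTranspose_apply, characterMatrix, h]
  rw [← Finset.sum_div, AddChar.sum_apply_eq_ite, Matrix.one_apply]
  by_cases hr : r = r'
  · simp [hr, hN]
  · simp [hr, sub_eq_zero, Ne.symm hr]

/-- A one-sided inverse is two-sided because `Y` has as many characters as elements. -/
theorem characterMatrix_mul_conjTranspose_self :
    characterMatrix Y * (characterMatrix Y).conjTranspose = 1 :=
  (Matrix.mul_eq_one_comm_of_card_eq _ _ _ (by rw [AddChar.card_eq])).1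
    conjTranspose_characterMatrix_mul_self

/-- The character transform of the response register, as a transformation of all registers. -/
noncomputable def registerTransform (X Y W : Type*) [Fintype X] [Fintype Y] [Fintype W]
    [AddCommGroup Y] : Matrix (X × AddChar Y ℂ × W) (X × Y × W) ℂ :=
  (1 : Matrix X X ℂ) ⊗ₖ (characterMatrix Y ⊗ₖ (1 : Matrix W W ℂ))

theorem conjTranspose_registerTransform_mul_self :
    (registerTransform X Y W).conjTranspose * registerTransform X Y W = 1 := by
  simp only [registerTransform, Matrix.conjTranspose_kronecker, ← Matrix.mul_kronecker_mul,
    conjTranspose_characterMatrix_mul_self, Matrix.conjTranspose_one, mul_one,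
    Matrix.one_kronecker_one]

theorem registerTransform_mul_conjTranspose_self :
    registerTransform X Y W * (registerTransform X Y W).conjTranspose = 1 := by
  simp only [registerTransform, Matrix.conjTranspose_kronecker, ← Matrix.mul_kronecker_mul,
    characterMatrix_mul_conjTranspose_self, Matrix.conjTranspose_one, mul_one,
    Matrix.one_kronecker_one]

theorem registerTransform_mulVec (ψ : X × Y × W → ℂ) (b : X × AddChar Y ℂ × W) :
    (registerTransform X Y W).mulVec ψ b
      = ∑ r, b.2.1 r / (√(Fintype.card Y) : ℂ) * ψ (b.1, r, b.2.2) := by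
  simp only [Matrix.mulVec, dotProduct, registerTransform, Matrix.kroneckerMap_apply,
    Fintype.sum_prod_type, characterMatrix, Matrix.one_apply]
  simp

/-- Phase kickback: characters diagonalise translation of the response register. -/
theorem registerTransform_mulVec_standardQuery (H : X → Y) (ψ : X × Y × W → ℂ)
    (b : X × AddChar Y ℂ × W) :
    (registerTransform X Y W).mulVec (QueryAlgorithm.standardQuery H ψ) b
      = b.2.1 (H b.1) * (registerTransform X Y W).mulVec ψ b := by
  rw [registerTransform_mulVec, registerTransform_mulVec,
    ← Equiv.sum_comp (Equiv.addRight (H b.1)), Finset.mul_sum]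
  refine Finset.sum_congr rfl fun r _ => ?_
  simp only [QueryAlgorithm.standardQuery, Equiv.coe_addRight, add_sub_cancel_right,
    AddChar.map_add_eq_mul]
  ring

namespace QueryAlgorithm

/-- The algorithm in the character basis of the response register. -/
noncomputable def characterForm (A : QueryAlgorithm X Y W) :
    QueryAlgorithm X (AddChar Y ℂ) W where
  init := (registerTransform X Y W).mulVec A.init
  init_norm := (sum_norm_mulVec_sq _ conjTranspose_registerTransform_mul_self _).trans A.init_norm
  U i := ⟨registerTransform X Y W * (A.U i : Matrix (X × Y × W) (X × Y × W) ℂ)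
      * (registerTransform X Y W).conjTranspose,
    by
      rw [Matrix.mem_unitaryGroup_iff, Matrix.star_eq_conjTranspose]
      have hU := Matrix.mem_unitaryGroup_iff.1 (A.U i).2
      rw [Matrix.star_eq_conjTranspose] at hU
      simp only [Matrix.conjTranspose_mul, Matrix.conjTranspose_conjTranspose]
      calc _ = registerTransform X Y W * (A.U i : Matrix (X × Y × W) (X × Y × W) ℂ)
            * ((registerTransform X Y W).conjTranspose * registerTransform X Y W)
            * (A.U i : Matrix (X × Y × W) (X × Y × W) ℂ).conjTranspose * (registerTransform X Y W).conjTranspose := by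
              simp only [Matrix.mul_assoc]
        _ = 1 := by
          rw [conjTranspose_registerTransform_mul_self, Matrix.mul_one,
            Matrix.mul_assoc (registerTransform X Y W), hU, Matrix.mul_one,
            registerTransform_mul_conjTranspose_self]⟩

/-- The run on a fixed function `H` is obtained from the joint state with the compressed
database. -/
theorem registerTransform_mulVec_standardState (A : QueryAlgorithm X Y W) (H : X → Y) (i : ℕ)
    (a : X × AddChar Y ℂ × W) :
    (registerTransform X Y W).mulVec (A.standardState H i) a
      = ∑ E : X → AddChar Y ℂ, A.characterForm.fourierState i a E * ∏ x, E x (H x) := by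
  induction i generalizing a with
  | zero =>
    rw [Finset.sum_eq_single 0]
    · simp [fourierState, standardState, characterForm]
    · intro E _ hE; simp [fourierState, hE]
    · simp
  | succ i ih =>
    have h1 : (registerTransform X Y W).mulVec (A.standardState H (i + 1))
        = (A.characterForm.U i : Matrix (X × AddChar Y ℂ × W) (X × AddChar Y ℂ × W) ℂ).mulVec
          ((registerTransform X Y W).mulVec (standardQuery H (A.standardState H i))) := by
      simp only [standardState, characterForm, Matrix.mulVec_mulVec]
      rw [Matrix.mul_assoc, conjTranspose_registerTransform_mul_self, Matrix.mul_one]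
    have h2 : ∀ b : X × AddChar Y ℂ × W,
        (registerTransform X Y W).mulVec (standardQuery H (A.standardState H i)) b
          = ∑ E : X → AddChar Y ℂ,
            compressedQuery (A.characterForm.fourierState i) b E * ∏ x, E x (H x) := by
      intro b
      rw [registerTransform_mulVec_standardQuery, ih]
      -- Adding `u` to the entry at the queried input multiplies the product of the `E x (H x)` by
      -- the phase `u (H x)` of the query.
      let e : (X → AddChar Y ℂ) ≃ (X → AddChar Y ℂ) :=
        { toFun := fun E => Function.update E b.1 (E b.1 + b.2.1)
          invFun := fun E => Function.update E b.1 (E b.1 - b.2.1)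
          left_inv := fun E => by simp
          right_inv := fun E => by simp }
      refine Eq.trans ?_ (e.sum_comp _)
      rw [Finset.mul_sum]
      refine Finset.sum_congr rfl fun E _ => ?_
      have h3 : Function.update (e E) b.1 (e E b.1 - b.2.1) = E := e.left_inv E
      rw [compressedQuery, h3, ← Finset.mul_prod_erase _ _ (Finset.mem_univ b.1),
        ← Finset.mul_prod_erase _ _ (Finset.mem_univ b.1)]
      have h4 : ∏ x ∈ Finset.univ.erase b.1, e E x (H x)
          = ∏ x ∈ Finset.univ.erase b.1, E x (H x) :=
        Finset.prod_congr rfl fun z hz => by simp [e, Finset.ne_of_mem_erase hz]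
      have h5 : e E b.1 = E b.1 + b.2.1 := by simp [e]
      rw [h4, h5, AddChar.add_apply]
      ring
    rw [h1]
    simp only [Matrix.mulVec, dotProduct, fourierState] at h2 ⊢
    simp only [h2, Finset.mul_sum, Finset.sum_mul]
    rw [Finset.sum_comm]
    simp only [mul_assoc]

end QueryAlgorithm

end CharacterTransform

/-! ### The success probability and the query lower bound -/

namespace QueryAlgorithm

open scoped Classical

variable {X Y W : Type*} [Fintype X] [Fintype Y] [Fintype W] [AddCommGroup Y]

/-- The Fourier amplitudes of the database, with the registers in the original basis. -/
noncomputable def databaseAmplitude (A : QueryAlgorithm X Y W) (q : ℕ) (a : X × Y × W)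
    (E : X → AddChar Y ℂ) : ℂ :=
  (registerTransform X Y W).conjTranspose.mulVec (fun b => A.characterForm.fourierState q b E) a

/-- The factor `√N ^ |X|` undoes the normalisation of the uniform superposition over `H`; squared,
it is the number of functions that `successProb` divides by. -/
theorem standardState_eq_mixedState (A : QueryAlgorithm X Y W) (H : X → Y) (q : ℕ)
    (a : X × Y × W) :
    A.standardState H q a = (√(Fintype.card Y) : ℂ) ^ Fintype.card X
      * mixedState (A.databaseAmplitude q a) Finset.univ (fun x => some (H x)) := by
  have hr : (√(Fintype.card Y) : ℂ) ≠ 0 := by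
    have : (0 : ℝ) < Fintype.card Y := by exact_mod_cast Fintype.card_pos
    exact_mod_cast (Real.sqrt_pos.2 this).ne'
  have h1 : A.standardState H q = (registerTransform X Y W).conjTranspose.mulVec
      ((registerTransform X Y W).mulVec (A.standardState H q)) := by
    rw [Matrix.mulVec_mulVec, conjTranspose_registerTransform_mul_self, Matrix.one_mulVec]
  rw [h1, funext (A.registerTransform_mulVec_standardState H q)]
  simp only [mixedState, fullAmplitude, databaseAmplitude, Matrix.mulVec, dotProduct,
    Finset.mul_sum, Finset.sum_mul, Finset.mem_univ, if_true, Finset.prod_div_distrib,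
    Finset.prod_const, Finset.card_univ]
  rw [Finset.sum_comm]
  refine Finset.sum_congr rfl fun E _ => Finset.sum_congr rfl fun b _ => ?_
  field_simp

theorem sum_norm_mixedState_databaseAmplitude_sq (A : QueryAlgorithm X Y W) (q : ℕ)
    (D : X → Option Y) :
    ∑ a, ‖mixedState (A.databaseAmplitude q a) ∅ D‖ ^ 2
      = ∑ b, ‖A.characterForm.phaseState q b D‖ ^ 2 := by
  rw [← sum_norm_mulVec_sq (registerTransform X Y W).conjTranspose
    (by rw [Matrix.conjTranspose_conjTranspose, registerTransform_mul_conjTranspose_self])]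
  refine Finset.sum_congr rfl fun a _ => ?_
  congr 2
  simp only [phaseState_eq_mixedState, mixedState, databaseAmplitude, Matrix.mulVec, dotProduct,
    Finset.mul_sum, Finset.sum_mul]
  rw [Finset.sum_comm]
  simp only [mul_assoc]

theorem sum_mixedState_databaseAmplitude_eq (A : QueryAlgorithm X Y W) (q m : ℕ) :
    (∑ a, ∑ D : X → Option Y, if HasCollisions D m
        then ‖mixedState (A.databaseAmplitude q a) ∅ D‖ ^ 2 else 0)
      = A.characterForm.collisionWeight q m := by
  rw [collisionWeight, Finset.sum_comm,
    Finset.sum_comm (s := (Finset.univ : Finset (X × AddChar Y ℂ × W)))]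
  refine Finset.sum_congr rfl fun D _ => ?_
  split_ifs
  · exact A.sum_norm_mixedState_databaseAmplitude_sq q D
  · simp

theorem successProb_eq (A : QueryAlgorithm X Y W) (q : ℕ) {j : ℕ}
    (out : X × Y × W → Fin j → X × X) :
    A.successProb q out = ∑ a, ∑ H : X → Y, if IsCollisionList (fun x => some (H x)) (out a)
      then ‖mixedState (A.databaseAmplitude q a) Finset.univ (fun x => some (H x))‖ ^ 2
      else 0 := by
  have hN : (0 : ℝ) < Fintype.card Y := by exact_mod_cast Fintype.card_pos
  have hsq : ∀ H a, ‖A.standardState H q a‖ ^ 2 = (Fintype.card Y : ℝ) ^ Fintype.card X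
      * ‖mixedState (A.databaseAmplitude q a) Finset.univ (fun x => some (H x))‖ ^ 2 := by
    intro H a
    rw [standardState_eq_mixedState, norm_mul, mul_pow, norm_pow, Complex.norm_real,
      Real.norm_of_nonneg (Real.sqrt_nonneg _), ← pow_mul, mul_comm _ 2, pow_mul,
      Real.sq_sqrt hN.le]
  rw [successProb, Fintype.card_fun, div_eq_iff (by positivity), Finset.sum_comm, Finset.sum_mul]
  refine Finset.sum_congr rfl fun a _ => ?_
  rw [Finset.sum_mul]
  refine Finset.sum_congr rfl fun H _ => ?_
  split_ifs
  · rw [hsq, Nat.cast_pow]; ring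
  · simp

theorem successProb_le (A : QueryAlgorithm X Y W) (q : ℕ) {j : ℕ}
    (out : X × Y × W → Fin j → X × X) :
    A.successProb q out ≤ 4 ^ j * (A.characterForm.collisionAmplitude q ((j + 1) / 2) ^ 2
      + (1 / Fintype.card Y) ^ ((j + 1) / 2)) := by
  suffices h : A.successProb q out ≤ 4 ^ j * (A.characterForm.collisionWeight q ((j + 1) / 2)
      + (1 / Fintype.card Y) ^ ((j + 1) / 2) * A.characterForm.collisionWeight q 0) by
    rwa [collisionWeight_zero_right, mul_one,
      ← Real.sq_sqrt (collisionWeight_nonneg _ _ ((j + 1) / 2)),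
      ← collisionAmplitude_eq_sqrt] at h
  rw [successProb_eq, ← sum_mixedState_databaseAmplitude_eq,
    ← sum_mixedState_databaseAmplitude_eq]
  simp only [HasCollisions.zero, if_true]
  rw [Finset.mul_sum, ← Finset.sum_add_distrib, Finset.mul_sum]
  refine Finset.sum_le_sum fun a _ => ?_
  refine le_trans ?_ (sum_isCollisionList_mixedState_univ_le (A.databaseAmplitude q a) (out a))
  let F : (X → Option Y) → ℝ := fun D => if IsCollisionList D (out a)
    then ‖mixedState (A.databaseAmplitude q a) Finset.univ D‖ ^ 2 else 0
  have hinj : Function.Injective fun (H : X → Y) (x : X) => some (H x) :=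
    fun H H' h => funext fun x => Option.some_injective _ (congrFun h x)
  -- Total functions are among the databases, so the sum only grows when partial ones are allowed.
  calc _ = ∑ D ∈ Finset.univ.image fun (H : X → Y) (x : X) => some (H x), F D :=
        (Finset.sum_image hinj.injOn).symm
    _ ≤ ∑ D, F D := Finset.sum_le_univ_sum_of_nonneg fun D => by
        simp only [F]; split_ifs <;> positivity

theorem collisionAmplitude_lt (A : QueryAlgorithm X (AddChar Y ℂ) W) {i j : ℕ} (hi : 1 ≤ i)
    (hj : 1 ≤ j) : A.collisionAmplitude i j
      < (Real.exp 1 * (i : ℝ) ^ (3 / 2 : ℝ) / (j * √(Fintype.card Y))) ^ j := by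
  have hN : (0 : ℝ) < Fintype.card Y := by exact_mod_cast Fintype.card_pos
  have hi0 : (0 : ℝ) < i := by exact_mod_cast hi
  have hj0 : (0 : ℝ) < j := by exact_mod_cast hj
  have hf : (0 : ℝ) < j.factorial := by exact_mod_cast j.factorial_pos
  refine (A.collisionAmplitude_le i j).trans_lt ?_
  have e : Real.exp 1 * (i : ℝ) ^ (3 / 2 : ℝ) / (j * √(Fintype.card Y))
      = Real.exp 1 / j * ((i : ℝ) ^ (3 / 2 : ℝ) / √(Fintype.card Y)) := by
    rw [div_mul_div_comm]
  rw [e, mul_pow, div_eq_inv_mul]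
  refine mul_lt_mul_of_pos_right ?_ (by positivity)
  rw [div_pow, inv_eq_one_div, div_lt_div_iff₀ hf (by positivity), one_mul]
  exact pow_self_lt_exp_mul_factorial hj

theorem le_queries_of_le_successProb (A : QueryAlgorithm X Y W) {q j : ℕ}
    (out : X × Y × W → Fin j → X × X) {p : ℝ} (hp0 : 0 < p) (hp1 : p ≤ 1)
    (hN : 32 / p ≤ Fintype.card Y) (hj : 1 ≤ j) (hp : p ≤ A.successProb q out) :
    (√(p / 2) / (8 * Real.exp 1)) ^ (2 / 3 : ℝ) * (j : ℝ) ^ (2 / 3 : ℝ)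
      * (Fintype.card Y : ℝ) ^ (1 / 3 : ℝ) ≤ q := by
  have hN0 : (0 : ℝ) < Fintype.card Y := by exact_mod_cast Fintype.card_pos
  set N : ℝ := ((Fintype.card Y : ℕ) : ℝ) with hNdef
  set m := (j + 1) / 2 with hm
  have hm1 : 1 ≤ m := by omega
  have hjm : j ≤ 2 * m := by omega
  set f := A.characterForm.collisionAmplitude q m with hf
  have hf0 : 0 ≤ f := Real.sqrt_nonneg _
  set r := √(p / 2) with hr
  have hr0 : 0 < r := Real.sqrt_pos.2 (by positivity)
  have hr2 : r ^ 2 = p / 2 := Real.sq_sqrt (by positivity)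
  have hr1 : r ≤ 1 := Real.sqrt_le_one.2 (by linarith)
  have h4 : (4 : ℝ) ^ j ≤ 16 ^ m := by
    calc (4 : ℝ) ^ j ≤ 4 ^ (2 * m) := pow_le_pow_right₀ (by norm_num) hjm
      _ = 16 ^ m := by rw [pow_mul]; norm_num
  -- The threshold `32/p` makes `16/N ≤ p/2 ≤ 1`, so higher powers are no larger; the other half of
  -- `p` is left for `f`.
  have hsmall : 16 ^ m * (1 / N) ^ m ≤ p / 2 := by
    have h32 : 32 ≤ p * N := by rw [div_le_iff₀ hp0] at hN; linarith
    have h1 : 16 * (1 / N) ≤ p / 2 := by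
      rw [mul_one_div, div_le_div_iff₀ hN0 (by norm_num)]; linarith
    rw [← mul_pow]
    exact (pow_le_of_le_one (by positivity) (by linarith) (by omega)).trans h1
  have hbig : r ≤ 4 ^ m * f := by
    have h1 : p ≤ 16 ^ m * (f ^ 2 + (1 / N) ^ m) :=
      (hp.trans (A.successProb_le q out)).trans
        (mul_le_mul_of_nonneg_right h4 (by positivity))
    have h2 : r ^ 2 ≤ (4 ^ m * f) ^ 2 := by
      have : (4 ^ m * f) ^ 2 = 16 ^ m * f ^ 2 := by
        rw [mul_pow, ← pow_mul, mul_comm m 2, pow_mul]; norm_num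
      rw [hr2, this]
      linarith
    exact le_of_sq_le_sq h2 (by positivity)
  -- The strict bound needs a query; without one the database is empty and `f = 0`.
  have hq : 1 ≤ q := by
    by_contra hq
    obtain rfl : q = 0 := by omega
    obtain ⟨m', hm'⟩ := Nat.exists_eq_succ_of_ne_zero (show m ≠ 0 by omega)
    rw [hf, hm', Nat.succ_eq_add_one, collisionAmplitude_zero_left, mul_zero] at hbig
    linarith
  have hq0 : (0 : ℝ) < q := by exact_mod_cast hq
  have hm0 : (0 : ℝ) < m := by exact_mod_cast hm1
  have hB := A.characterForm.collisionAmplitude_lt hq hm1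
  rw [← hf, ← hNdef] at hB
  set B := Real.exp 1 * (q : ℝ) ^ (3 / 2 : ℝ) / (m * √N) with hBdef
  have hB0 : 0 < B := by positivity
  -- From `r ≤ 4^m f < (4B)^m`: if `4B ≤ r ≤ 1`, the power would be at most `4B ≤ r`. This makes the
  -- constant independent of `j`.
  have hrB : r < 4 * B := by
    by_contra hle
    push Not at hle
    have h1 : (4 * B) ^ m ≤ 4 * B := pow_le_of_le_one (by positivity) (hle.trans hr1) (by omega)
    have h2 : 4 ^ m * f < (4 * B) ^ m := by
      rw [mul_pow]; exact mul_lt_mul_of_pos_left hB (by positivity)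
    linarith
  have hmain : r / (8 * Real.exp 1) * j * √N ≤ (q : ℝ) ^ (3 / 2 : ℝ) := by
    have hjm' : (j : ℝ) ≤ 2 * m := by exact_mod_cast hjm
    have hs : 0 < √N := Real.sqrt_pos.2 hN0
    have h1 : r * (m * √N) < 4 * (Real.exp 1 * (q : ℝ) ^ (3 / 2 : ℝ)) := by
      rw [hBdef, ← mul_div_assoc, lt_div_iff₀ (by positivity)] at hrB
      exact hrB
    have h2 : r * (j * √N) ≤ r * (2 * m * √N) := by gcongr
    rw [div_mul_eq_mul_div, div_mul_eq_mul_div, div_le_iff₀ (by positivity)]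
    nlinarith
  have hfin := Real.rpow_le_rpow (by positivity) hmain (show (0 : ℝ) ≤ 2 / 3 by norm_num)
  rw [← Real.rpow_mul hq0.le, Real.mul_rpow (by positivity) (by positivity),
    Real.mul_rpow (by positivity) (by positivity), Real.sqrt_eq_rpow, ← Real.rpow_mul hN0.le]
    at hfin
  norm_num at hfin ⊢
  exact hfin

end QueryAlgorithm

theorem mainTheorem7 :
    (∀ (X Y W : Type*) [Fintype X] [Fintype Y] [Fintype W] [AddCommGroup Y]
      (A : QueryAlgorithm X (AddChar Y ℂ) W) (i j : ℕ), 1 ≤ i → 1 ≤ j →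
        A.collisionAmplitude i j
          < (Real.exp 1 * (i : ℝ) ^ (3 / 2 : ℝ) / (j * Real.sqrt (Fintype.card Y))) ^ j) ∧
    (∀ p : ℝ, 0 < p → ∃ c : ℝ, 0 < c ∧ ∃ N₀ : ℕ,
      ∀ (X Y W : Type*) [Fintype X] [Fintype Y] [Fintype W] [AddCommGroup Y]
        (A : QueryAlgorithm X Y W) (q j : ℕ) (out : X × Y × W → Fin j → X × X),
        N₀ ≤ Fintype.card Y → 1 ≤ j → p ≤ A.successProb q out →
          c * (j : ℝ) ^ (2 / 3 : ℝ) * (Fintype.card Y : ℝ) ^ (1 / 3 : ℝ) ≤ q) := by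
  refine ⟨fun X Y W _ _ _ _ A i j hi hj => A.collisionAmplitude_lt hi hj, fun p hp => ?_⟩
  -- The lower bound is proved for thresholds at most 1, so `p` is replaced by `min p 1`, which
  -- weakens the assumption on the success probability.
  have hp0 : 0 < min p 1 := lt_min hp one_pos
  refine ⟨(√(min p 1 / 2) / (8 * Real.exp 1)) ^ (2 / 3 : ℝ), by positivity, ⌈32 / min p 1⌉₊, ?_⟩
  intro X Y W _ _ _ _ A q j out hN hj hpA
  exact A.le_queries_of_le_successProb out hp0 (min_le_right _ _)
    ((Nat.le_ceil _).trans (by exact_mod_cast hN)) hj ((min_le_left _ _).trans hpA)
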